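/- A Weihrauch problem (with instances in $\mathbb N^{\mathbb N}$ and solutions in $\mathbb N$) is a set $P\subseteq\mathbb N^{\mathbb N}\times\mathbb N$ of pairs (instance, solution), and $\operatorname{dom}(P)$ is the set of instances that have a solution. Write $P\le_{\mathrm{sW}}Q$ if there are a computable partial functional $\Phi$ on $\mathbb N^{\mathbb N}$ and a partial computable function $\Psi$ on $\mathbb N$ such that for every $p\in\operatorname{dom}(P)$, $\Phi(p)$ is defined and lies in $\operatorname{dom}(Q)$, and for every $y$ with $(\Phi(p),y)\in Q$, $\Psi(y)$ is defined and $(p,\Psi(y))\in P$. Write $P\equiv_{\mathrm{sW}}Q$ if $P\le_{\mathrm{sW}}Q$ and $Q\le_{\mathrm{sW}}P$. Finite subsets of $\mathbb N$ are coded by their canonical indices ($S\mapsto\sum_{i\in S}2^i$), and tuples of numbers, functions and sets are coded by single functions in the usual way. $\mathsf C^{\subset}_{\max}$ is the following problem. An instance is a number $n\in\mathbb N$ and a function $f$ from $\mathbb N$ to the nonempty finite subsets of $\mathbb N$ whose range includes all finite sets of cardinality at least $n$. A solution is a finite set $X\subset\mathbb N$ with $X\notin\operatorname{range}(f)$ such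 that every finite $Y\supsetneq X$ is in $\operatorname{range}(f)$. $\mathsf{VSB}_{<\omega}$ is the following problem. An instance is a number $n\in\mathbb N$ and a countable vector space $V$ over a countable field $K$ (both with underlying sets contained in $\mathbb N$, given by these sets, the field operations, vector addition, scalar multiplication and the constants) such that every set of $n$ vectors of $V$ is linearly dependent. A solution is a basis of $V$, which is a finite set and is given by its canonical index. Let $\mathsf{VSB}^{\mathbb Q}_{<\omega}$ be its restriction to the vector spaces over $K=\mathbb Q$ (with a fixed standard coding of $\mathbb Q$). **Theorem.** $\mathsf{VSB}_{<\omega}\equiv_{\mathrm{sW}}\mathsf C^{\subset}_{\max}$, and likewise $\mathsf{VSB}^{\mathbb Q}_{<\omega}\equiv_{\mathrm{sW}}\mathsf C^{\subset}_{\max}$. -/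

import Mathlib

/-! ## Strong Weihrauch reducibility -/

/-- The finite initial segment `⟨p 0, …, p (k - 1)⟩` of a point `p` of Baire space. -/
def initSeg (p : ℕ → ℕ) (k : ℕ) : List ℕ := (List.range k).map p

/-- The partial functional on Baire space given by `φ` is defined at `p` and has the value `q` there.
To find `q m`, the functional feeds longer and longer initial segments of the oracle `p` to `φ`, until
`φ` answers for the first time. When `φ` ranges over the (total) computable functions, the partial
functionals that arise in this way are exactly the partial computable (Turing) functionals. -/
def FunctionalValue (φ : List ℕ → ℕ → Option ℕ) (p q : ℕ → ℕ) : Prop :=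
  ∀ m, ∃ k, φ (initSeg p k) m = some (q m) ∧ ∀ j < k, φ (initSeg p j) m = none

/-- Weihrauch problems with instances in Baire space and solutions in `ℕ`: sets of pairs
(instance, solution). -/
abbrev WeihrauchProblem : Type := Set ((ℕ → ℕ) × ℕ)

/-- The instances of `P` that have a solution. -/
def WeihrauchProblem.dom (P : WeihrauchProblem) : Set (ℕ → ℕ) := {p | ∃ x, (p, x) ∈ P}

/-- `P ≤_sW Q`: a computable functional `Φ` (given by `φ`) turns every instance `p` of `P` into an
instance `q = Φ p` of `Q`, and a partial computable function `ψ`, which has no access to `p`, turns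
every solution of `q` into a solution of `p`. -/
def StrongWeihrauchReducible (P Q : WeihrauchProblem) : Prop :=
  ∃ φ : List ℕ → ℕ → Option ℕ, Computable₂ φ ∧ ∃ ψ : ℕ →. ℕ, Partrec ψ ∧
    ∀ p ∈ P.dom, ∃ q, FunctionalValue φ p q ∧ q ∈ Q.dom ∧
      ∀ y, (q, y) ∈ Q → ∃ x ∈ ψ y, (p, x) ∈ P

/-- `P ≡_sW Q`. -/
def StrongWeihrauchEquiv (P Q : WeihrauchProblem) : Prop :=
  StrongWeihrauchReducible P Q ∧ StrongWeihrauchReducible Q P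

/-! ## Picking a maximal set in the complement of an enumeration -/

/-- The finite set with canonical index `x`, i.e. the `S` with `x = ∑ i ∈ S, 2 ^ i`. -/
def finsetOfCode (x : ℕ) : Finset ℕ := x.bitIndices.toFinset

/-- The problem `C^⊂_max`. The instance `(n, f)` is coded by `p` with `p 0 = n` and `p (k + 1)` the
canonical index of `f k`; the solution is given by its canonical index. -/
def CMaxSubset : WeihrauchProblem :=
  {(p, x) | ∃ (n : ℕ) (f : ℕ → Finset ℕ) (X : Finset ℕ),
    p 0 = n ∧ (∀ k, finsetOfCode (p (k + 1)) = f k) ∧ finsetOfCode x = X ∧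
    (∀ k, f k ≠ ∅) ∧
    (∀ Y : Finset ℕ, n ≤ Y.card → Y ∈ Set.range f) ∧
    X ∉ Set.range f ∧
    ∀ Y : Finset ℕ, X ⊂ Y → Y ∈ Set.range f}

/-! ## The vector space basis problem for bounded dimension -/

/-- The `i`-th function coded by `p`. -/
def component (p : ℕ → ℕ) (i : ℕ) : ℕ → ℕ := fun x => p (Nat.pair i x)

/-- `p` is a name of the countable vector space `V` over the countable field `K`, where scalars and
vectors are identified with natural numbers by the injections `κ` and `ν`. The name lists the sets of
scalars and of vectors (as the sets where a function has the value `1`), the operations of `K` and `V`,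
and the constants. The values of the operations off `K` and `V` are arbitrary. -/
structure IsVectorSpaceName (p : ℕ → ℕ) {K V : Type} [Field K] [AddCommGroup V] [Module K V]
    (κ : K → ℕ) (ν : V → ℕ) : Prop where
  injective_scalar : Function.Injective κ
  injective_vector : Function.Injective ν
  scalars : ∀ x, component p 1 x = 1 ↔ x ∈ Set.range κ
  scalar_zero : component p 2 0 = κ 0
  scalar_one : component p 2 1 = κ 1
  scalar_add : ∀ a b, component p 3 (Nat.pair (κ a) (κ b)) = κ (a + b)
  scalar_mul : ∀ a b, component p 4 (Nat.pair (κ a) (κ b)) = κ (a * b)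
  vectors : ∀ x, component p 5 x = 1 ↔ x ∈ Set.range ν
  vector_zero : component p 6 0 = ν 0
  vector_add : ∀ v w, component p 7 (Nat.pair (ν v) (ν w)) = ν (v + w)
  vector_smul : ∀ a v, component p 8 (Nat.pair (κ a) (ν v)) = ν (a • v)

/-- `p` codes a number `n` (as its value at the pair `(0, 0)`) and a vector space over `K`, with
scalars coded by `κ`, in which every set of `n` vectors is linearly dependent; and `x` is the
canonical index of the (finite) set of codes of the elements of a basis. -/
def IsBasisSolution (p : ℕ → ℕ) (x : ℕ) (K : Type) [Field K] (κ : K → ℕ) : Prop :=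
  ∃ (V : Type) (_ : AddCommGroup V) (_ : Module K V) (ν : V → ℕ),
    IsVectorSpaceName p κ ν ∧
    (∀ S : Finset V, S.card = component p 0 0 → ¬ LinearIndepOn K id (S : Set V)) ∧
    ∃ B : Set V, LinearIndepOn K id B ∧ Submodule.span K B = ⊤ ∧
      (finsetOfCode x : Set ℕ) = ν '' B

/-- The problem `VSB_{<ω}`: the instances are `n` and a countable vector space, over any countable
field, in which every set of `n` vectors is linearly dependent; the solutions are its bases. -/
def VSBBounded : WeihrauchProblem :=
  {(p, x) | ∃ (K : Type) (_ : Field K) (κ : K → ℕ), IsBasisSolution p x K κ}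

/-- A code for the rational `q`, through its numerator and denominator in lowest terms. -/
def ratCode (q : ℚ) : ℕ := Nat.pair (Nat.pair q.num.toNat (-q.num).toNat) q.den

/-- The restriction of `VSB_{<ω}` to vector spaces over the field `ℚ` (in its standard coding). -/
def VSBBoundedRat : WeihrauchProblem :=
  {(p, x) | IsBasisSolution p x ℚ ratCode}

/-! From vector spaces to `CMaxSubset`: a number that is no vector, or a linear dependence, shows
itself in a finite part of the name, so the finite sets that are not linearly independent sets of
vectors can be enumerated. The bases are exactly the maximal sets that are never enumerated
(`isBasis_iff`), and the dimension bound puts all sets of size at least `n` into the enumeration. A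
solution is a basis as it stands.

Conversely, an enumeration `f` is turned into a space over `ℚ`. A machine keeps a stack, a strict
chain of nonempty finite sets, each with a generator of its own. If some set on the stack has been
enumerated, the top is popped; otherwise the first available proper superset of the top is pushed.
Permanent sets are never enumerated and so form a chain of length less than `n`. Hence there is a
longest permanent bottom part `F`, and its top, or the empty set if `F` is empty, is a maximal set
outside the enumeration (`IsLimitStack.mem_range_of_ssubset`).

The operations of the space must be computed while the stack still changes. A popped generator is
therefore not set to zero, which could destroy an earlier inequality, but equated with a multiple of
the permanent generator `0`, so large that no linear relation among combinations with small codes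
changes its truth value (`isLinear_stackStep_iff`). The result is a copy of `ℚ × (Fin F.length → ℚ)`
(`IsLimitStack.exists_eval`).

The backward functional does not see `f`, so the code of a vector contains an initial segment of
`f`. A basis needs a vector that involves the top generator of `F`; hence its largest element knows
a stage at which `F` is already the bottom of the stack. The size of the basis, `F.length + 1`,
tells how far `F` reaches (`decodeBasis_eq`). -/

/-! ### Primitive recursive predicates and canonical indices of finite sets. -/

section Computability

variable {α β : Type} [Primcodable α] [Primcodable β]

theorem PrimrecPred.forall_mem {p : α × β → Prop} (hp : PrimrecPred p) {f : α → List β}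
    (hf : Primrec f) : PrimrecPred fun a => ∀ b ∈ f a, p (a, b) :=
  (PrimrecRel.forall_mem_list (R := fun b a => p (a, b)) hp.primrecRel.swap).comp hf Primrec.id

theorem PrimrecPred.exists_mem {p : α × β → Prop} (hp : PrimrecPred p) {f : α → List β}
    (hf : Primrec f) : PrimrecPred fun a => ∃ b ∈ f a, p (a, b) :=
  (PrimrecRel.exists_mem_list (R := fun b a => p (a, b)) hp.primrecRel.swap).comp hf Primrec.id

theorem PrimrecPred.forall_lt_of {p : α × ℕ → Prop} (hp : PrimrecPred p) {f : α → ℕ}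
    (hf : Primrec f) : PrimrecPred fun a => ∀ b < f a, p (a, b) :=
  (hp.forall_mem (Primrec.list_range.comp hf)).of_eq (by simp)

theorem PrimrecPred.exists_lt_of {p : α × ℕ → Prop} (hp : PrimrecPred p) {f : α → ℕ}
    (hf : Primrec f) : PrimrecPred fun a => ∃ b < f a, p (a, b) :=
  (hp.exists_mem (Primrec.list_range.comp hf)).of_eq (by simp)

theorem PrimrecPred.imp {p q : α → Prop} (hp : PrimrecPred p) (hq : PrimrecPred q) :
    PrimrecPred fun a => p a → q a :=
  (hp.not.or hq).of_eq fun _ => (imp_iff_not_or).symm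

open Classical in
theorem Primrec.list_filter_of {f : α → List β} {p : α → β → Prop} (hf : Primrec f)
    (hp : PrimrecRel p) : Primrec fun a => (f a).filter fun b => decide (p a b) :=
  (PrimrecRel.listFilter (R := fun b a => p a b) hp.swap).comp hf Primrec.id

theorem Primrec.nat_pow : Primrec₂ ((· ^ ·) : ℕ → ℕ → ℕ) :=
  Primrec₂.unpaired'.1 Nat.Primrec.pow

/-- A bounded search for the greatest common divisor; the bound `a + b` also covers the case that
one argument is zero. -/
theorem Primrec.nat_gcd : Primrec₂ Nat.gcd := by
  classical
  have hdvd : PrimrecRel fun (a : ℕ × ℕ) (d : ℕ) => a.1 % d = 0 ∧ a.2 % d = 0 :=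
    (Primrec.eq.comp (Primrec.nat_mod.comp (Primrec.fst.comp Primrec.fst) Primrec.snd)
      (Primrec.const 0)).and
    (Primrec.eq.comp (Primrec.nat_mod.comp (Primrec.snd.comp Primrec.fst) Primrec.snd)
      (Primrec.const 0))
  have h := Primrec.nat_findGreatest (f := fun a : ℕ × ℕ => a.1 + a.2)
    (Primrec.nat_add.comp Primrec.fst Primrec.snd) hdvd
  refine h.of_eq fun ⟨a, b⟩ => ?_
  simp only
  rw [Nat.findGreatest_eq_iff]
  refine ⟨?_, fun _ => ⟨Nat.mod_eq_zero_of_dvd (Nat.gcd_dvd_left a b),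
    Nat.mod_eq_zero_of_dvd (Nat.gcd_dvd_right a b)⟩, ?_⟩
  · rcases Nat.eq_zero_or_pos a with rfl | ha
    · simp
    · exact (Nat.gcd_le_left b ha).trans (Nat.le_add_right a b)
  · rintro d hd hle ⟨h1, h2⟩
    have hg : d ∣ Nat.gcd a b := Nat.dvd_gcd (Nat.dvd_of_mod_eq_zero h1) (Nat.dvd_of_mod_eq_zero h2)
    rcases Nat.eq_zero_or_pos (Nat.gcd a b) with h0 | h0
    · rw [Nat.gcd_eq_zero_iff] at h0
      omega
    · exact absurd (Nat.le_of_dvd h0 hg) (by omega)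

theorem mem_finsetOfCode {i x : ℕ} : i ∈ finsetOfCode x ↔ x.testBit i = true := by
  simp [finsetOfCode]

theorem lt_of_mem_finsetOfCode {i x : ℕ} (h : i ∈ finsetOfCode x) : i < x := by
  have h1 : 2 ^ i ≤ x := Nat.two_pow_le_of_mem_bitIndices (by simpa [finsetOfCode] using h)
  exact Nat.lt_two_pow_self.trans_le h1

@[simp] theorem finsetOfCode_sum (s : Finset ℕ) : finsetOfCode (∑ i ∈ s, 2 ^ i) = s := by
  simp [finsetOfCode]

theorem finsetOfCode_injective : Function.Injective finsetOfCode := fun x y h => by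
  rw [← Finset.sum_toFinset_bitIndices_two_pow x, ← Finset.sum_toFinset_bitIndices_two_pow y]
  simp only [finsetOfCode] at h
  rw [h]

theorem finsetOfCode_surjective : Function.Surjective finsetOfCode := fun s =>
  ⟨_, finsetOfCode_sum s⟩

@[simp] theorem finsetOfCode_zero : finsetOfCode 0 = ∅ := by simp [finsetOfCode]

theorem primrecRel_mem_finsetOfCode : PrimrecRel fun x i => i ∈ finsetOfCode x := by
  have h : PrimrecRel fun x i : ℕ => x / 2 ^ i % 2 = 1 :=
    Primrec.eq.comp (Primrec.nat_mod.comp (Primrec.nat_div.comp Primrec.fst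
      (Primrec.nat_pow.comp (Primrec.const 2) Primrec.snd)) (Primrec.const 2)) (Primrec.const 1)
  refine h.of_eq fun x i => ?_
  rw [mem_finsetOfCode, Nat.testBit_eq_decide_div_mod_eq, decide_eq_true_eq]

theorem primrecRel_finsetOfCode_ssubset :
    PrimrecRel fun x y => finsetOfCode x ⊂ finsetOfCode y := by
  have h : PrimrecRel fun x y : ℕ => x ≠ y ∧ ∀ i < x, i ∈ finsetOfCode x → i ∈ finsetOfCode y := by
    have hmem : PrimrecPred fun a : (ℕ × ℕ) × ℕ =>
        a.2 ∈ finsetOfCode a.1.1 → a.2 ∈ finsetOfCode a.1.2 :=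
      (primrecRel_mem_finsetOfCode.comp (Primrec.fst.comp Primrec.fst) Primrec.snd).imp
        (primrecRel_mem_finsetOfCode.comp (Primrec.snd.comp Primrec.fst) Primrec.snd)
    exact (Primrec.eq.comp Primrec.fst Primrec.snd).not.and (hmem.forall_lt_of Primrec.fst)
  refine h.of_eq fun x y => ?_
  rw [Finset.ssubset_iff_subset_ne, and_comm]
  refine and_congr ⟨fun h i hi => h i (lt_of_mem_finsetOfCode hi) hi, fun h i _ hi => h hi⟩
    finsetOfCode_injective.ne_iff.symm

end Computability

/-! ### Initial segments of the oracle and two kinds of functionals. -/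

section Functionals

@[simp] theorem length_initSeg (p : ℕ → ℕ) (k : ℕ) : (initSeg p k).length = k := by
  simp [initSeg]

theorem initSeg_succ (p : ℕ → ℕ) (k : ℕ) : initSeg p (k + 1) = initSeg p k ++ [p k] := by
  simp [initSeg, List.range_succ]

theorem getElem?_initSeg (p : ℕ → ℕ) (k i : ℕ) :
    (initSeg p k)[i]? = if i < k then some (p i) else none := by
  by_cases h : i < k <;> simp [initSeg, h]

theorem tail_initSeg (p : ℕ → ℕ) (k : ℕ) :
    (initSeg p (k + 1)).tail = initSeg (fun i => p (i + 1)) k := by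
  simp [initSeg, List.range_succ_eq_map, Function.comp_def]

theorem headI_initSeg (p : ℕ → ℕ) (k : ℕ) : (initSeg p (k + 1)).headI = p 0 := by
  simp [initSeg, List.range_succ_eq_map]

theorem take_initSeg (p : ℕ → ℕ) {j k : ℕ} (h : j ≤ k) :
    (initSeg p k).take j = initSeg p j := by
  simp [initSeg, ← List.map_take, List.take_range, h]

/-- The functional that computes `G` from an initial segment of the length `g`. -/
theorem functionalValue_of_length (g : ℕ → ℕ) (G : List ℕ → ℕ → ℕ) (p : ℕ → ℕ) :
    FunctionalValue (fun l m => if l.length = g m then some (G l m) else none) p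
      fun m => G (initSeg p (g m)) m := by
  intro m
  refine ⟨g m, by simp, fun j hj => ?_⟩
  simp [hj.ne]

open Classical in
/-- The functional that searches for the value with the relation `R`. -/
noncomputable def searchFunctional (R : List ℕ → ℕ → ℕ → Prop) (c : ℕ) (l : List ℕ) (m : ℕ) :
    Option ℕ :=
  if m + c < l.length then ((List.range l.length).filter fun z => decide (R l m z)).head? else none

/-- On prefixes longer than `m + c` the only possible hit is `q m`, so the filtered list is empty or
the singleton of `q m`, and the first answer is the right one. -/
theorem functionalValue_search {R : List ℕ → ℕ → ℕ → Prop} {c : ℕ} {p q : ℕ → ℕ}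
    (h : ∀ k m z, m + c < k → z < k → (R (initSeg p k) m z ↔ z = q m)) :
    FunctionalValue (searchFunctional R c) p q := by
  classical
  intro m
  have key : ∀ k, searchFunctional R c (initSeg p k) m =
      if m + c < k ∧ q m < k then some (q m) else none := by
    intro k
    by_cases hk : m + c < k
    · have : (List.range k).filter (fun z => decide (R (initSeg p k) m z)) =
          (List.range k).filter (fun z => z == q m) := by
        refine List.filter_congr fun z hz => ?_
        rw [Bool.eq_iff_iff]
        simpa using h k m z hk (by simpa using hz)
      simp only [searchFunctional, length_initSeg, hk, this, if_true, true_and]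
      rw [List.filter_beq, List.nodup_range.count]
      by_cases hq : q m < k <;> simp [hq]
    · simp [searchFunctional, hk]
  refine ⟨max (m + c) (q m) + 1, ?_, fun j hj => ?_⟩
  · rw [key, if_pos]
    constructor <;> omega
  · rw [key, if_neg]
    omega

theorem primrec₂_searchFunctional {R : List ℕ → ℕ → ℕ → Prop} {c : ℕ}
    (hR : PrimrecPred fun a : (List ℕ × ℕ) × ℕ => R a.1.1 a.1.2 a.2) :
    Primrec₂ (searchFunctional R c) := by
  classical
  refine Primrec.ite (Primrec.nat_lt.comp (Primrec.nat_add.comp Primrec.snd (Primrec.const c))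
    (Primrec.list_length.comp Primrec.fst)) ?_ (Primrec.const none)
  exact Primrec.list_head?.comp (Primrec.list_filter_of
    (p := fun (a : List ℕ × ℕ) z => R a.1 a.2 z)
    (Primrec.list_range.comp (Primrec.list_length.comp Primrec.fst)) hR)

end Functionals

/-! ### Primitive recursive arithmetic of rational numbers. -/

section RationalCodes

/-- The rational number with the code `z`. -/
def scal (z : ℕ) : ℚ := ((z.unpair.1.unpair.1 : ℚ) - z.unpair.1.unpair.2) / z.unpair.2

@[simp] theorem scal_ratCode (q : ℚ) : scal (ratCode q) = q := by
  have h : ((q.num.toNat : ℚ) - (-q.num).toNat) = q.num := by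
    have := Int.toNat_sub_toNat_neg q.num
    exact_mod_cast this
  simp only [scal, ratCode, Nat.unpair_pair]
  rw [h, Rat.num_div_den]

theorem ratCode_injective : Function.Injective ratCode :=
  Function.LeftInverse.injective scal_ratCode

@[simp] theorem scal_zero : scal 0 = 0 := by simp [scal]

/-- The bound `k + 1` instead of `k` leaves room for the fraction `0 / 1`, which replaces the codes
with denominator zero. -/
theorem exists_scal_eq_div {z k : ℕ} (h : z ≤ k) :
    ∃ (a : ℤ) (d : ℕ), 0 < d ∧ d ≤ k + 1 ∧ scal z = a / d := by
  rcases Nat.eq_zero_or_pos z.unpair.2 with h0 | h0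
  · exact ⟨0, 1, one_pos, by omega, by simp [scal, h0]⟩
  · exact ⟨z.unpair.1.unpair.1 - z.unpair.1.unpair.2, z.unpair.2, h0,
      (Nat.unpair_right_le z).trans (by omega), by simp [scal]⟩

theorem abs_scal_le {z k : ℕ} (h : z ≤ k) : |scal z| ≤ k := by
  rcases Nat.eq_zero_or_pos z.unpair.2 with h0 | h0
  · simp [scal, h0]
  · have h1 : z.unpair.1 ≤ k := (Nat.unpair_left_le z).trans h
    have h2 : (z.unpair.1.unpair.1 : ℚ) ≤ k := by
      exact_mod_cast (Nat.unpair_left_le _).trans h1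
    have h3 : (z.unpair.1.unpair.2 : ℚ) ≤ k := by
      exact_mod_cast (Nat.unpair_right_le _).trans h1
    have h4 : (1 : ℚ) ≤ z.unpair.2 := by exact_mod_cast h0
    have h5 : |(z.unpair.1.unpair.1 : ℚ) - z.unpair.1.unpair.2| ≤ k := by
      rw [abs_sub_le_iff]
      constructor <;> linarith [(Nat.cast_nonneg z.unpair.1.unpair.1 : (0 : ℚ) ≤ _),
        (Nat.cast_nonneg z.unpair.1.unpair.2 : (0 : ℚ) ≤ _)]
    rw [scal, abs_div, Nat.abs_cast]
    exact (div_le_self (abs_nonneg _) h4).trans h5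

variable {α β : Type} [Primcodable α] [Primcodable β]

/-- With truncated subtraction, one of `a - b` and `b - a` is zero and their sum is the absolute
value of the difference. This reduces a fraction to lowest terms inside the natural numbers. -/
theorem ratCode_sub_div (a b d : ℕ) : ratCode (((a : ℚ) - b) / d) =
    if d = 0 then Nat.pair 0 1 else
      Nat.pair (Nat.pair ((a - b) / Nat.gcd (a - b + (b - a)) d)
        ((b - a) / Nat.gcd (a - b + (b - a)) d)) (d / Nat.gcd (a - b + (b - a)) d) := by
  split_ifs with h
  · subst h
    simp only [Nat.cast_zero, div_zero]
    rfl
  have hd : 0 < d := Nat.pos_of_ne_zero h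
  set n : ℤ := (a : ℤ) - b with hn
  have hab : a - b + (b - a) = n.natAbs := by omega
  have hq : ((a : ℚ) - b) / d = Rat.divInt n d := by
    rw [Rat.divInt_eq_div, hn]
    push_cast
    rfl
  have hnum : (Rat.divInt n d).num = n / (Nat.gcd n.natAbs d : ℕ) := by
    rw [Rat.num_divInt]
    have : (d : ℤ).sign = 1 := Int.sign_eq_one_of_pos (by exact_mod_cast hd)
    rw [this, one_mul, Int.gcd_comm]
    rfl
  have hden : (Rat.divInt n d).den = d / Nat.gcd n.natAbs d := by
    rw [Rat.den_divInt, if_neg (by exact_mod_cast h), Int.gcd_comm]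
    rfl
  have hg : 0 < Nat.gcd n.natAbs d := Nat.gcd_pos_of_pos_right _ hd
  have hdvd : ((Nat.gcd n.natAbs d : ℕ) : ℤ) ∣ n :=
    Int.natCast_dvd.2 (Nat.gcd_dvd_left _ _)
  rw [hq, ratCode, hnum, hden, hab]
  generalize Nat.gcd n.natAbs d = g at hg hdvd
  rcases le_total b a with hle | hle
  · have h1 : n = ((a - b : ℕ) : ℤ) := by omega
    have h2 : b - a = 0 := by omega
    rw [h1, h2, ← Int.natCast_div]
    generalize (a - b) / g = m
    simp
  · have h1 : n = -((b - a : ℕ) : ℤ) := by omega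
    have h2 : a - b = 0 := by omega
    have h3 : -(n / (g : ℤ)) = ((b - a) / g : ℕ) := by
      rw [← Int.neg_ediv_of_dvd hdvd, h1, neg_neg, Int.natCast_div]
    have h4 : n / (g : ℤ) = -((b - a) / g : ℕ) := by rw [← h3, neg_neg]
    rw [h4, h2]
    generalize (b - a) / g = m
    simp

/-- The rational-valued function `g` is primitive recursive, with respect to the codes. -/
def RatPrimrec (g : α → ℚ) : Prop := Primrec fun a => ratCode (g a)

namespace RatPrimrec

theorem sub_div {a b d : α → ℕ} (ha : Primrec a) (hb : Primrec b) (hd : Primrec d) :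
    RatPrimrec fun x => ((a x : ℚ) - b x) / d x := by
  classical
  have h1 := Primrec.nat_sub.comp ha hb
  have h2 := Primrec.nat_sub.comp hb ha
  have hg := Primrec.nat_gcd.comp (Primrec.nat_add.comp h1 h2) hd
  refine (Primrec.ite (c := fun x => d x = 0) (Primrec.eq.comp hd (Primrec.const 0))
    (Primrec.const (Nat.pair 0 1))
    (Primrec₂.natPair.comp (Primrec₂.natPair.comp (Primrec.nat_div.comp h1 hg)
      (Primrec.nat_div.comp h2 hg)) (Primrec.nat_div.comp hd hg))).of_eq fun x => ?_
  rw [ratCode_sub_div]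

theorem scal_comp {f : α → ℕ} (hf : Primrec f) : RatPrimrec fun a => scal (f a) := by
  have h := Primrec.unpair.comp hf
  have h1 := Primrec.unpair.comp (Primrec.fst.comp h)
  exact sub_div (Primrec.fst.comp h1) (Primrec.snd.comp h1) (Primrec.snd.comp h)

theorem natCast {f : α → ℕ} (hf : Primrec f) : RatPrimrec fun a => (f a : ℚ) := by
  refine Primrec.of_eq (sub_div hf (Primrec.const 0) (Primrec.const 1)) fun a => ?_
  simp

theorem comp {g : β → ℚ} {f : α → β} (hg : RatPrimrec g) (hf : Primrec f) :
    RatPrimrec fun a => g (f a) :=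
  Primrec.comp (f := fun b => ratCode (g b)) hg hf

theorem add {f g : α → ℚ} (hf : RatPrimrec f) (hg : RatPrimrec g) :
    RatPrimrec fun a => f a + g a := by
  have h : Primrec₂ fun x y : ℕ => ratCode (scal x + scal y) := by
    have h1 := Primrec.unpair.comp (Primrec.fst (α := ℕ) (β := ℕ))
    have h2 := Primrec.unpair.comp (Primrec.snd (α := ℕ) (β := ℕ))
    have h3 := Primrec.unpair.comp (Primrec.fst.comp h1)
    have h4 := Primrec.unpair.comp (Primrec.fst.comp h2)
    have d1 := Primrec.snd.comp h1
    have d2 := Primrec.snd.comp h2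
    have A := Primrec.nat_add.comp (Primrec.nat_mul.comp (Primrec.fst.comp h3) d2)
      (Primrec.nat_mul.comp (Primrec.fst.comp h4) d1)
    have B := Primrec.nat_add.comp (Primrec.nat_mul.comp (Primrec.snd.comp h3) d2)
      (Primrec.nat_mul.comp (Primrec.snd.comp h4) d1)
    have main := sub_div A B (Primrec.nat_mul.comp d1 d2)
    classical
    refine (Primrec.ite (c := fun p : ℕ × ℕ => p.1.unpair.2 = 0)
      (Primrec.eq.comp d1 (Primrec.const 0)) (scal_comp Primrec.snd)
      (Primrec.ite (c := fun p : ℕ × ℕ => p.2.unpair.2 = 0)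
      (Primrec.eq.comp d2 (Primrec.const 0)) (scal_comp Primrec.fst) main)).of_eq
        fun ⟨x, y⟩ => ?_
    by_cases hx : x.unpair.2 = 0
    · simp [hx, scal]
    by_cases hy : y.unpair.2 = 0
    · simp [hx, hy, scal]
    have hx' : (x.unpair.2 : ℚ) ≠ 0 := by exact_mod_cast hx
    have hy' : (y.unpair.2 : ℚ) ≠ 0 := by exact_mod_cast hy
    simp only [hx, hy, if_false, scal]
    congr 1
    push_cast
    field_simp
    ring
  refine (h.comp hf hg).of_eq fun a => ?_
  simp

theorem mul {f g : α → ℚ} (hf : RatPrimrec f) (hg : RatPrimrec g) :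
    RatPrimrec fun a => f a * g a := by
  have h : Primrec₂ fun x y : ℕ => ratCode (scal x * scal y) := by
    have h1 := Primrec.unpair.comp (Primrec.fst (α := ℕ) (β := ℕ))
    have h2 := Primrec.unpair.comp (Primrec.snd (α := ℕ) (β := ℕ))
    have h3 := Primrec.unpair.comp (Primrec.fst.comp h1)
    have h4 := Primrec.unpair.comp (Primrec.fst.comp h2)
    have A := Primrec.nat_add.comp (Primrec.nat_mul.comp (Primrec.fst.comp h3) (Primrec.fst.comp h4))
      (Primrec.nat_mul.comp (Primrec.snd.comp h3) (Primrec.snd.comp h4))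
    have B := Primrec.nat_add.comp (Primrec.nat_mul.comp (Primrec.fst.comp h3) (Primrec.snd.comp h4))
      (Primrec.nat_mul.comp (Primrec.snd.comp h3) (Primrec.fst.comp h4))
    refine (sub_div A B (Primrec.nat_mul.comp (Primrec.snd.comp h1) (Primrec.snd.comp h2))).of_eq
        fun ⟨x, y⟩ => ?_
    simp only [scal]
    congr 1
    push_cast
    rw [div_mul_div_comm]
    congr 1
    ring
  refine (h.comp hf hg).of_eq fun a => ?_
  simp

theorem eq {f g : α → ℚ} (hf : RatPrimrec f) (hg : RatPrimrec g) :
    PrimrecPred fun a => f a = g a :=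
  (Primrec.eq.comp hf hg).of_eq fun _ => ratCode_injective.eq_iff

theorem sum_map {f : α → List β} {g : α → β → ℚ} (hf : Primrec f)
    (hg : RatPrimrec fun a : α × β => g a.1 a.2) :
    RatPrimrec fun a => ((f a).map (g a)).sum := by
  have h : Primrec₂ fun (a : α) (s : β × ℕ) => ratCode (g a s.1 + scal s.2) :=
    add (hg.comp (Primrec.pair Primrec.fst (Primrec.fst.comp Primrec.snd)))
      (scal_comp (Primrec.snd.comp Primrec.snd))
  refine (Primrec.list_foldr hf (Primrec.const (ratCode 0)) h).of_eq fun a => ?_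
  dsimp only
  generalize f a = l
  induction l with
  | nil => simp
  | cons b l ih => simp_all

end RatPrimrec

end RationalCodes

/-! ### Linear dependence is enumerable from a name; bases are the maximal unrefuted sets. -/

section Dependence

/-- The value at `x` of the `i`-th function coded by a point with the initial segment `l`. -/
def query (l : List ℕ) (i x : ℕ) : Option ℕ := l[Nat.pair i x]?

open Classical in
/-- The part below `n` of the linear combination of the vectors in `finsetOfCode x` with the
coefficients `c`, computed from the initial segment `l` of a name. -/
noncomputable def combination (l : List ℕ) (x : ℕ) (c : List ℕ) (n : ℕ) : Option ℕ :=
  (List.range n).foldl (fun s i => if i ∈ finsetOfCode x then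
    s.bind fun u => (query l 8 (Nat.pair (c.getD i 0) i)).bind fun v => query l 7 (Nat.pair u v)
    else s) (query l 6 0)

/-- The initial segment `l` of a name shows that `finsetOfCode x` has an element that is no vector,
or that `c` lists the coefficients of a linear dependence. -/
def Refutes (l : List ℕ) (x : ℕ) (c : List ℕ) : Prop :=
  (∃ i < x, i ∈ finsetOfCode x ∧ query l 5 i ≠ none ∧ query l 5 i ≠ some 1) ∨
  (∀ i < x, i ∈ finsetOfCode x → query l 5 i = some 1 ∧ query l 1 (c.getD i 0) = some 1) ∧
  (∃ i < x, i ∈ finsetOfCode x ∧ query l 2 0 ≠ none ∧ query l 2 0 ≠ some (c.getD i 0)) ∧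
  query l 6 0 ≠ none ∧ combination l x c x = query l 6 0

variable {α : Type} [Primcodable α]

theorem Primrec.query {l : α → List ℕ} {i x : α → ℕ} (hl : Primrec l) (hi : Primrec i)
    (hx : Primrec x) : Primrec fun a => query (l a) (i a) (x a) :=
  Primrec.list_getElem?.comp hl (Primrec₂.natPair.comp hi hx)

theorem Primrec.combination {l : α → List ℕ} {x n : α → ℕ} {c : α → List ℕ} (hl : Primrec l)
    (hx : Primrec x) (hc : Primrec c) (hn : Primrec n) :
    Primrec fun a => combination (l a) (x a) (c a) (n a) := by
  classical
  have hi : Primrec fun b : α × Option ℕ × ℕ => b.2.2 := Primrec.snd.comp Primrec.snd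
  have h : Primrec₂ fun (a : α) (s : Option ℕ × ℕ) => if s.2 ∈ finsetOfCode (x a) then
      s.1.bind fun u => (_root_.query (l a) 8 (Nat.pair ((c a).getD s.2 0) s.2)).bind fun v =>
        _root_.query (l a) 7 (Nat.pair u v) else s.1 := by
    refine Primrec.ite (primrecRel_mem_finsetOfCode.comp (hx.comp Primrec.fst) hi)
      (Primrec.option_bind (Primrec.fst.comp Primrec.snd) ?_) (Primrec.fst.comp Primrec.snd)
    refine Primrec.option_bind ?_ ?_
    · exact Primrec.query (hl.comp (Primrec.fst.comp Primrec.fst)) (Primrec.const 8)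
        (Primrec₂.natPair.comp ((Primrec.list_getD 0).comp (hc.comp (Primrec.fst.comp Primrec.fst))
          (hi.comp Primrec.fst)) (hi.comp Primrec.fst))
    · exact Primrec.query (hl.comp (Primrec.fst.comp (Primrec.fst.comp Primrec.fst)))
        (Primrec.const 7) (Primrec₂.natPair.comp (Primrec.snd.comp Primrec.fst) Primrec.snd)
  exact (Primrec.list_foldl (Primrec.list_range.comp hn)
    (Primrec.query hl (Primrec.const 6) (Primrec.const 0)) h).of_eq fun a => rfl

theorem PrimrecPred.refutes {l : α → List ℕ} {x : α → ℕ} {c : α → List ℕ} (hl : Primrec l)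
    (hx : Primrec x) (hc : Primrec c) : PrimrecPred fun a => Refutes (l a) (x a) (c a) := by
  have hl' : Primrec fun b : α × ℕ => l b.1 := hl.comp Primrec.fst
  have hmem : PrimrecPred fun b : α × ℕ => b.2 ∈ finsetOfCode (x b.1) :=
    primrecRel_mem_finsetOfCode.comp (hx.comp Primrec.fst) Primrec.snd
  have h5 := Primrec.query hl' (Primrec.const 5) Primrec.snd
  have hci : Primrec fun b : α × ℕ => (c b.1).getD b.2 0 :=
    (Primrec.list_getD 0).comp (hc.comp Primrec.fst) Primrec.snd
  have h1 := Primrec.query hl' (Primrec.const 1) hci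
  have h2 := Primrec.query hl' (Primrec.const 2) (Primrec.const 0)
  have h6 := Primrec.query hl (Primrec.const 6) (Primrec.const 0)
  exact ((hmem.and ((Primrec.eq.comp h5 (Primrec.const none)).not.and
    (Primrec.eq.comp h5 (Primrec.const (some 1))).not)).exists_lt_of hx).or
    (((hmem.imp ((Primrec.eq.comp h5 (Primrec.const (some 1))).and
    (Primrec.eq.comp h1 (Primrec.const (some 1))))).forall_lt_of hx).and
    (((hmem.and ((Primrec.eq.comp h2 (Primrec.const none)).not.and
    (Primrec.eq.comp h2 (Primrec.option_some.comp hci)).not)).exists_lt_of hx).and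
    ((Primrec.eq.comp h6 (Primrec.const none)).not.and
    (Primrec.eq.comp (Primrec.combination hl hx hc hx) h6))))

theorem component_eq_of_query {p : ℕ → ℕ} {k i x v : ℕ} (h : query (initSeg p k) i x = some v) :
    component p i x = v := by
  rw [query, getElem?_initSeg] at h
  split_ifs at h
  exact Option.some.inj h

theorem component_eq_of_query_ne_none {p : ℕ → ℕ} {k i x : ℕ}
    (h : query (initSeg p k) i x ≠ none) :
    query (initSeg p k) i x = some (component p i x) := by
  obtain ⟨v, hv⟩ := Option.ne_none_iff_exists'.1 h
  rw [hv, component_eq_of_query hv]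

theorem eventually_query (p : ℕ → ℕ) (i x : ℕ) :
    ∀ᶠ k in Filter.atTop, query (initSeg p k) i x = some (component p i x) := by
  filter_upwards [Filter.eventually_gt_atTop (Nat.pair i x)] with k hk
  rw [query, getElem?_initSeg, if_pos hk, component]

variable {K V : Type} [Field K] [AddCommGroup V] [Module K V] {p : ℕ → ℕ} {κ : K → ℕ} {ν : V → ℕ}

-- Soundness: a prefix that is too short gives `none`, never a wrong vector.
open Classical in
theorem eq_of_combination (h : IsVectorSpaceName p κ ν) {x : ℕ} {c : List ℕ} {a : ℕ → K}
    {w : ℕ → V} (ha : ∀ i ∈ finsetOfCode x, κ (a i) = c.getD i 0)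
    (hw : ∀ i ∈ finsetOfCode x, ν (w i) = i) {k n v : ℕ}
    (hv : combination (initSeg p k) x c n = some v) :
    v = ν (∑ i ∈ Finset.range n, if i ∈ finsetOfCode x then a i • w i else 0) := by
  induction n generalizing v with
  | zero =>
    have := component_eq_of_query (by simpa [combination] using hv)
    simpa [h.vector_zero] using this.symm
  | succ n ih =>
    rw [combination, List.range_succ, List.foldl_append, ← combination] at hv
    rw [Finset.sum_range_succ]
    simp only [List.foldl_cons, List.foldl_nil] at hv
    split_ifs at hv with hn
    · obtain ⟨u, hu, hv⟩ := Option.bind_eq_some_iff.1 hv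
      obtain ⟨t, ht, hv⟩ := Option.bind_eq_some_iff.1 hv
      have h8 := component_eq_of_query ht
      have h7 := component_eq_of_query hv
      rw [← ha n hn, show Nat.pair (κ (a n)) n = Nat.pair (κ (a n)) (ν (w n)) by rw [hw n hn],
        h.vector_smul] at h8
      rw [ih hu, ← h8, h.vector_add] at h7
      rw [if_pos hn, h7]
    · rw [if_neg hn, add_zero, ih hv]

-- Completeness: each step of the fold needs at most two more entries of the name.
open Classical in
theorem eventually_combination (h : IsVectorSpaceName p κ ν) {x : ℕ} {c : List ℕ} {a : ℕ → K}
    {w : ℕ → V} (ha : ∀ i ∈ finsetOfCode x, κ (a i) = c.getD i 0)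
    (hw : ∀ i ∈ finsetOfCode x, ν (w i) = i) (n : ℕ) :
    ∀ᶠ k in Filter.atTop, combination (initSeg p k) x c n =
      some (ν (∑ i ∈ Finset.range n, if i ∈ finsetOfCode x then a i • w i else 0)) := by
  induction n with
  | zero =>
    filter_upwards [eventually_query p 6 0] with k hk
    simpa [combination, h.vector_zero] using hk
  | succ n ih =>
    filter_upwards [ih, eventually_query p 8 (Nat.pair (c.getD n 0) n),
      eventually_query p 7 (Nat.pair (ν (∑ i ∈ Finset.range n,
        if i ∈ finsetOfCode x then a i • w i else 0)) (ν (a n • w n)))] with k h1 h2 h3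
    rw [combination, List.range_succ, List.foldl_append, ← combination, h1,
      Finset.sum_range_succ]
    simp only [List.foldl_cons, List.foldl_nil]
    split_ifs with hn
    · rw [Option.bind_some, h2]
      rw [← ha n hn, show Nat.pair (κ (a n)) n = Nat.pair (κ (a n)) (ν (w n)) by rw [hw n hn],
        h.vector_smul, Option.bind_some, h3, h.vector_add]
    · rw [add_zero]

/-- `finsetOfCode x` is no set of vectors, or it is a linearly dependent one. -/
def IsRefuted (p : ℕ → ℕ) (x : ℕ) : Prop :=
  ∃ (c : List ℕ) (k : ℕ), Refutes (initSeg p k) x c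

theorem IsVectorSpaceName.exists_inverse (h : IsVectorSpaceName p κ ν) :
    ∃ w : ℕ → V, (∀ v, w (ν v) = v) ∧ ∀ i, i ∈ Set.range ν → ν (w i) = i :=
  ⟨Function.invFun ν, Function.leftInverse_invFun h.injective_vector,
    fun _ hi => Function.invFun_eq hi⟩

/-- One list `c` works for all long prefixes. This is needed because the enumeration inspects a
prefix whose length is dictated by the argument. -/
theorem eventually_refutes (h : IsVectorSpaceName p κ ν) {w : ℕ → V}
    (hw : ∀ i, i ∈ Set.range ν → ν (w i) = i) {x : ℕ}
    (hx : (∀ i ∈ finsetOfCode x, i ∈ Set.range ν) → ¬ LinearIndepOn K w (finsetOfCode x)) :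
    ∃ c, ∀ᶠ k in Filter.atTop, Refutes (initSeg p k) x c := by
  classical
  by_cases hr : ∀ i ∈ finsetOfCode x, i ∈ Set.range ν
  · have hd := hx hr
    rw [linearIndepOn_finset_iff] at hd
    push Not at hd
    obtain ⟨a, ha, i, hi, hai⟩ := hd
    -- The elements of `finsetOfCode x` are smaller than `x`, so a list of length `x` holds all
    -- their coefficients.
    set c : List ℕ := (List.range x).map fun i => κ (a i) with hc
    have hca : ∀ i ∈ finsetOfCode x, κ (a i) = c.getD i 0 := fun i hi => by
      simp [hc, lt_of_mem_finsetOfCode hi]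
    have hsum : (∑ i ∈ Finset.range x, if i ∈ finsetOfCode x then a i • w i else 0) = 0 := by
      rw [← Finset.sum_filter, ← ha]
      congr 1
      ext j
      simp only [Finset.mem_filter, Finset.mem_range]
      exact ⟨fun h => h.2, fun h => ⟨lt_of_mem_finsetOfCode h, h⟩⟩
    have hquery : ∀ᶠ k in Filter.atTop, ∀ j ∈ Finset.range x,
        query (initSeg p k) 5 j = some (component p 5 j) ∧
        query (initSeg p k) 1 (c.getD j 0) = some (component p 1 (c.getD j 0)) :=
      (Finset.eventually_all _).2 fun j _ =>
        (eventually_query p 5 j).and (eventually_query p 1 (c.getD j 0))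
    refine ⟨c, ?_⟩
    filter_upwards [hquery, eventually_query p 2 0, eventually_query p 6 0,
      eventually_combination h hca (fun i hi => hw i (hr i hi)) x] with k h1 h2 h6 hs
    refine Or.inr ⟨fun j hj hjx => ?_, ⟨i, lt_of_mem_finsetOfCode hi, hi, by simp [h2], ?_⟩,
      by simp [h6], ?_⟩
    · obtain ⟨h5, h1⟩ := h1 j (by simpa using hj)
      rw [h5, h1, (h.vectors j).2 (hr j hjx), ← hca j hjx, (h.scalars _).2 ⟨_, rfl⟩]
      exact ⟨rfl, rfl⟩
    · rw [h2, h.scalar_zero, ← hca i hi]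
      intro h0
      exact hai (h.injective_scalar (Option.some.inj h0)).symm
    · rw [hs, h6, hsum, h.vector_zero]
  · push Not at hr
    obtain ⟨i, hi, hin⟩ := hr
    refine ⟨[], ?_⟩
    filter_upwards [eventually_query p 5 i] with k hk
    refine Or.inl ⟨i, lt_of_mem_finsetOfCode hi, hi, by simp [hk], ?_⟩
    rw [hk]
    exact fun h1 => hin ((h.vectors i).1 (Option.some.inj h1))

theorem isRefuted_iff (h : IsVectorSpaceName p κ ν) {w : ℕ → V}
    (hw : ∀ i, i ∈ Set.range ν → ν (w i) = i) {x : ℕ} :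
    IsRefuted p x ↔
      ((∀ i ∈ finsetOfCode x, i ∈ Set.range ν) → ¬ LinearIndepOn K w (finsetOfCode x)) := by
  classical
  constructor
  · rintro ⟨c, k, ⟨i, -, hi, h5, h5'⟩ | ⟨hall, ⟨i, -, hi, h2, h2'⟩, h6, hs⟩⟩ hr
    · rw [component_eq_of_query_ne_none h5] at h5'
      exact absurd (congrArg some ((h.vectors i).2 (hr i hi))) h5'
    · have hc : ∀ i ∈ finsetOfCode x, c.getD i 0 ∈ Set.range κ := fun i hi =>
        (h.scalars _).1 (component_eq_of_query (hall i (lt_of_mem_finsetOfCode hi) hi).2)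
      choose! a ha using hc
      rw [component_eq_of_query_ne_none h6] at hs
      have hs := eq_of_combination h ha (fun i hi => hw i (hr i hi)) hs
      rw [h.vector_zero, ← Finset.sum_filter] at hs
      have hf : (Finset.range x).filter (· ∈ finsetOfCode x) = finsetOfCode x := by
        ext j
        simp only [Finset.mem_filter, Finset.mem_range]
        exact ⟨fun h => h.2, fun h => ⟨lt_of_mem_finsetOfCode h, h⟩⟩
      rw [hf] at hs
      intro hli
      have h0 := linearIndepOn_finset_iff.1 hli a (h.injective_vector hs.symm) i hi
      rw [component_eq_of_query_ne_none h2, h.scalar_zero, ← ha i hi, h0] at h2'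
      exact h2' rfl
  · intro hx
    obtain ⟨c, hc⟩ := eventually_refutes h hw hx
    obtain ⟨k, hk⟩ := hc.exists
    exact ⟨c, k, hk⟩

/-- In a bounded-dimensional space, all sets with at least `n` elements are refuted. -/
theorem isRefuted_of_card (h : IsVectorSpaceName p κ ν) {n x : ℕ}
    (hn : ∀ S : Finset V, S.card = n → ¬ LinearIndepOn K id (S : Set V))
    (hx : n ≤ (finsetOfCode x).card) : IsRefuted p x := by
  classical
  obtain ⟨w, -, hw⟩ := h.exists_inverse
  rw [isRefuted_iff h hw]
  intro hr hli
  obtain ⟨T, hT, hTn⟩ := Finset.exists_subset_card_eq hx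
  have hinj : Set.InjOn w (finsetOfCode x : Set ℕ) := fun i hi j hj hij => by
    rw [← hw i (hr i hi), ← hw j (hr j hj), hij]
  have hT' : (T : Set ℕ) ⊆ finsetOfCode x := by exact_mod_cast hT
  refine hn (T.image w) ?_ ?_
  · rw [Finset.card_image_of_injOn (hinj.mono hT'), hTn]
  · rw [Finset.coe_image]
    exact (hli.mono hT').id_image

/-- The bases are the maximal sets among those that are not refuted. -/
theorem isBasis_iff (h : IsVectorSpaceName p κ ν) {x : ℕ} :
    (∃ B : Set V, LinearIndepOn K id B ∧ Submodule.span K B = ⊤ ∧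
      (finsetOfCode x : Set ℕ) = ν '' B) ↔
    ¬ IsRefuted p x ∧ ∀ y, finsetOfCode x ⊂ finsetOfCode y → IsRefuted p y := by
  classical
  obtain ⟨w, hwν, hw⟩ := h.exists_inverse
  have hinj : ∀ S : Set ℕ, S ⊆ Set.range ν → Set.InjOn w S := fun S hS i hi j hj hij => by
    rw [← hw i (hS hi), ← hw j (hS hj), hij]
  have hwB : ∀ B : Set V, w '' (ν '' B) = B := fun B => by
    rw [Set.image_image]
    simp [hwν]
  constructor
  · rintro ⟨B, hB, hspan, hxB⟩
    have hxr : ∀ i ∈ finsetOfCode x, i ∈ Set.range ν := fun i hi => by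
      have : i ∈ ν '' B := hxB ▸ (Finset.mem_coe.2 hi)
      exact Set.image_subset_range _ _ this
    refine ⟨?_, fun y hxy => ?_⟩
    · rw [isRefuted_iff h hw]
      intro hr
      refine hr hxr ?_
      rw [linearIndepOn_iff_image (hinj _ hxr), hxB, hwB]
      exact hB
    · rw [isRefuted_iff h hw]
      intro hyr hli
      obtain ⟨hsub, j, hjy, hjx⟩ := Finset.ssubset_iff_exists_subset_erase.1 hxy |>.elim
        fun j hj => (⟨hxy.1, j, hj.1, fun hjx => by simpa using hj.2 hjx⟩ :
          finsetOfCode x ⊆ finsetOfCode y ∧ ∃ j, j ∈ finsetOfCode y ∧ j ∉ finsetOfCode x)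
      have hli' : LinearIndepOn K w (insert j (finsetOfCode x : Set ℕ)) :=
        hli.mono (Set.insert_subset hjy (by exact_mod_cast hsub))
      have := ((linearIndepOn_insert (by exact_mod_cast hjx)).1 hli').2
      rw [hxB, hwB, hspan] at this
      exact this Submodule.mem_top
  · rintro ⟨hx, hmax⟩
    rw [isRefuted_iff h hw] at hx
    push Not at hx
    obtain ⟨hr, hli⟩ := hx
    refine ⟨w '' finsetOfCode x, hli.id_image, ?_, ?_⟩
    · rw [Submodule.eq_top_iff']
      by_contra hne
      push Not at hne
      obtain ⟨v, hv⟩ := hne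
      have hvx : ν v ∉ finsetOfCode x := fun hmem =>
        hv (Submodule.subset_span ⟨ν v, hmem, hwν v⟩)
      obtain ⟨y, hy⟩ := finsetOfCode_surjective (insert (ν v) (finsetOfCode x))
      have hy' := hmax y (hy ▸ Finset.ssubset_insert hvx)
      rw [isRefuted_iff h hw, hy] at hy'
      refine hy' ?_ ?_
      · intro i hi
        rcases Finset.mem_insert.1 hi with rfl | hi
        exacts [⟨v, rfl⟩, hr i hi]
      · rw [Finset.coe_insert, linearIndepOn_insert (by exact_mod_cast hvx), hwν]
        exact ⟨hli, hv⟩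
    · rw [Set.image_image]
      ext i
      constructor
      · exact fun hi => ⟨i, hi, hw i (hr i hi)⟩
      · rintro ⟨j, hj, rfl⟩
        simpa only [hw j (hr j hj)] using hj

end Dependence

/-! ### Reduction of the basis problems to `CMaxSubset`. -/

section ToCMax

/-- From a name of a vector space, the functional enumerates the sets that are refuted. -/
noncomputable def refutedCode (l : List ℕ) (m : ℕ) : ℕ :=
  open Classical in
  if m = 0 then l.headI
  else if Refutes l m.pred.unpair.1 (Denumerable.ofNat (List ℕ) m.pred.unpair.2.unpair.1) then
    m.pred.unpair.1
  else 2 ^ (l.headI + 1) - 1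

theorem primrec₂_refutedCode : Primrec₂ refutedCode := by
  classical
  have hu := Primrec.unpair.comp (Primrec.pred.comp (Primrec.snd (α := List ℕ) (β := ℕ)))
  have hh : Primrec fun a : List ℕ × ℕ => a.1.headI := Primrec.list_headI.comp Primrec.fst
  exact Primrec.ite (Primrec.eq.comp Primrec.snd (Primrec.const 0)) hh
    (Primrec.ite (PrimrecPred.refutes Primrec.fst (Primrec.fst.comp hu)
      ((Primrec.ofNat (List ℕ)).comp (Primrec.fst.comp (Primrec.unpair.comp (Primrec.snd.comp hu)))))
      (Primrec.fst.comp hu) (Primrec.nat_sub.comp (Primrec.nat_pow.comp (Primrec.const 2)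
        (Primrec.succ.comp hh)) (Primrec.const 1)))

theorem finsetOfCode_two_pow_sub_one (n : ℕ) : finsetOfCode (2 ^ n - 1) = Finset.range n := by
  rw [← finsetOfCode_sum (Finset.range n), Nat.geomSum_eq le_rfl]
  simp

theorem refutedCode_spec {K V : Type} [Field K] [AddCommGroup V] [Module K V] {p : ℕ → ℕ}
    {κ : K → ℕ} {ν : V → ℕ} (h : IsVectorSpaceName p κ ν)
    (hn : ∀ S : Finset V, S.card = component p 0 0 → ¬ LinearIndepOn K id (S : Set V)) (x : ℕ) :
    (∃ k, refutedCode (initSeg p (k + 2)) (k + 1) = x) ↔ IsRefuted p x := by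
  classical
  have hp0 : component p 0 0 = p 0 := rfl
  constructor
  · rintro ⟨k, rfl⟩
    rw [refutedCode, if_neg (Nat.succ_ne_zero k)]
    split_ifs with hr
    · exact ⟨_, _, hr⟩
    -- The default value codes `{0, …, n}`, which is refuted by its size alone, so it adds no wrong
    -- set to the enumeration.
    · refine isRefuted_of_card h hn ?_
      rw [finsetOfCode_two_pow_sub_one, headI_initSeg, Finset.card_range, hp0]
      omega
  · intro hx
    obtain ⟨w, -, hw⟩ := h.exists_inverse
    obtain ⟨c, hc⟩ := eventually_refutes h hw ((isRefuted_iff h hw).1 hx)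
    obtain ⟨N, hN⟩ := Filter.eventually_atTop.1 hc
    -- `N` is part of the argument only to make it large: a pair is at least as large as its
    -- components, so the inspected prefix is long enough.
    refine ⟨Nat.pair x (Nat.pair (Encodable.encode c) N), ?_⟩
    rw [refutedCode, if_neg (Nat.succ_ne_zero _), if_pos]
    · simp
    · simp only [Nat.pred_succ, Nat.unpair_pair, Denumerable.ofNat_encode]
      refine hN _ ?_
      have h1 := Nat.right_le_pair (Encodable.encode c) N
      have h2 := Nat.right_le_pair x (Nat.pair (Encodable.encode c) N)
      omega

/-- Solving the enumeration of the refuted sets of a name yields a basis. -/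
theorem strongWeihrauchReducible_cMaxSubset {P : WeihrauchProblem}
    (hP : ∀ p ∈ P.dom, ∃ (K V : Type) (_ : Field K) (_ : AddCommGroup V) (_ : Module K V)
      (κ : K → ℕ) (ν : V → ℕ), IsVectorSpaceName p κ ν ∧
      (∀ S : Finset V, S.card = component p 0 0 → ¬ LinearIndepOn K id (S : Set V)) ∧
      ∀ x, (p, x) ∈ P ↔ ∃ B : Set V, LinearIndepOn K id B ∧ Submodule.span K B = ⊤ ∧
        (finsetOfCode x : Set ℕ) = ν '' B) :
    StrongWeihrauchReducible P CMaxSubset := by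
  classical
  refine ⟨fun l m => if l.length = m + 1 then some (refutedCode l m) else none, ?_, ?_⟩
  · refine Primrec₂.to_comp (Primrec.ite (Primrec.eq.comp (Primrec.list_length.comp Primrec.fst)
      (Primrec.succ.comp Primrec.snd)) (Primrec.option_some.comp primrec₂_refutedCode)
      (Primrec.const none))
  refine ⟨fun y => Part.some y, Partrec.some, fun p hp => ?_⟩
  obtain ⟨K, V, _, _, _, κ, ν, h, hn, hsol⟩ := hP p hp
  refine ⟨_, functionalValue_of_length (fun m => m + 1) refutedCode p, ?_⟩
  set q : ℕ → ℕ := fun m => refutedCode (initSeg p (m + 1)) m with hq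
  have hrange : ∀ y, finsetOfCode y ∈ Set.range (fun k => finsetOfCode (q (k + 1))) ↔
      IsRefuted p y := fun y => by
    rw [← refutedCode_spec h hn y]
    exact exists_congr fun k => finsetOfCode_injective.eq_iff
  have key : ∀ x, (q, x) ∈ CMaxSubset ↔ (p, x) ∈ P := fun x => by
    rw [hsol, isBasis_iff h]
    constructor
    · rintro ⟨n, f, X, -, hf, rfl, -, -, hX, hmax⟩
      have hf' : f = fun k => finsetOfCode (q (k + 1)) := funext fun k => (hf k).symm
      subst hf'
      exact ⟨fun hx => hX ((hrange x).2 hx), fun y hy => (hrange y).1 (hmax _ hy)⟩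
    · rintro ⟨hx, hmax⟩
      refine ⟨q 0, _, _, rfl, fun k => rfl, rfl, ?_, fun Y hY => ?_, fun hx' => hx ((hrange x).1 hx'),
        fun Y hY => ?_⟩
      · intro k hk
        have h0 : IsRefuted p 0 := (hrange 0).1 ⟨k, by simpa using hk⟩
        obtain ⟨w, -, hw⟩ := h.exists_inverse
        refine (isRefuted_iff h hw).1 h0 (by simp) ?_
        simp
      · obtain ⟨y, rfl⟩ := finsetOfCode_surjective Y
        refine (hrange y).2 (isRefuted_of_card h hn ?_)
        have hq0 : q 0 = component p 0 0 := by
          simp only [hq, refutedCode, headI_initSeg, if_true]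
          rfl
        rwa [← hq0]
      · obtain ⟨y, rfl⟩ := finsetOfCode_surjective Y
        exact (hrange y).2 (hmax y hY)
  obtain ⟨x, hx⟩ := hp
  exact ⟨⟨x, (key x).2 hx⟩, fun y hy => ⟨y, Part.mem_some y, (key y).1 hy⟩⟩

/-- The problem quantifies over all presentations with the name `p`. By `isBasis_iff` they share the
same bases, since `IsRefuted` mentions only the name. -/
theorem mem_vsbBounded_iff {p : ℕ → ℕ} {K V : Type} [Field K] [AddCommGroup V] [Module K V]
    {κ : K → ℕ} {ν : V → ℕ} (h : IsVectorSpaceName p κ ν)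
    (hn : ∀ S : Finset V, S.card = component p 0 0 → ¬ LinearIndepOn K id (S : Set V)) (x : ℕ) :
    (p, x) ∈ VSBBounded ↔ ∃ B : Set V, LinearIndepOn K id B ∧ Submodule.span K B = ⊤ ∧
      (finsetOfCode x : Set ℕ) = ν '' B := by
  constructor
  · rintro ⟨K', _, κ', V', _, _, ν', h', -, hB⟩
    exact (isBasis_iff h).2 ((isBasis_iff h').1 hB)
  · exact fun hB => ⟨K, _, κ, V, _, _, ν, h, hn, hB⟩

theorem mem_vsbBoundedRat_iff {p : ℕ → ℕ} {V : Type} [AddCommGroup V] [Module ℚ V]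
    {ν : V → ℕ} (h : IsVectorSpaceName p ratCode ν)
    (hn : ∀ S : Finset V, S.card = component p 0 0 → ¬ LinearIndepOn ℚ id (S : Set V)) (x : ℕ) :
    (p, x) ∈ VSBBoundedRat ↔ ∃ B : Set V, LinearIndepOn ℚ id B ∧ Submodule.span ℚ B = ⊤ ∧
      (finsetOfCode x : Set ℕ) = ν '' B := by
  constructor
  · rintro ⟨V', _, _, ν', h', -, hB⟩
    exact (isBasis_iff h).2 ((isBasis_iff h').1 hB)
  · exact fun hB => ⟨V, _, _, ν, h, hn, hB⟩

theorem vsbBounded_reducible_cMaxSubset : StrongWeihrauchReducible VSBBounded CMaxSubset :=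
  strongWeihrauchReducible_cMaxSubset fun _ ⟨_, K, _, κ, V, _, _, ν, h, hn, _⟩ =>
    ⟨K, V, _, _, _, κ, ν, h, hn, mem_vsbBounded_iff h hn⟩

theorem vsbBoundedRat_reducible_cMaxSubset : StrongWeihrauchReducible VSBBoundedRat CMaxSubset :=
  strongWeihrauchReducible_cMaxSubset fun _ ⟨_, V, _, _, ν, h, hn, _⟩ =>
    ⟨ℚ, V, _, _, _, ratCode, ν, h, hn, mem_vsbBoundedRat_iff h hn⟩

end ToCMax

/-! ### The stack machine and the stability of linear relations. -/

section StackMachine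

/-- The states of the machine that looks for a maximal set outside an enumeration: the numbers
enumerated so far; the generators that have been killed, with the multiple of the generator `0` that
they have been made equal to; and the stack (top first) of the sets under consideration, with their
generators. -/
abbrev StackState : Type := List ℕ × List (ℕ × ℕ) × List (ℕ × ℕ)

/-- Some set on the stack has been enumerated. -/
def IsStale (s : StackState) : Prop := ∃ e ∈ s.2.2, e.1 ∈ s.1

open Classical in
/-- The proper supersets of the top of the stack that may be put on top of it. -/
noncomputable def candidates (s : StackState) : List ℕ :=
  (List.range s.1.length).filter fun y =>
    decide (y ∉ s.1 ∧ finsetOfCode s.2.2.headI.1 ⊂ finsetOfCode y)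

/-- A multiple that is large in comparison with all numbers used so far. -/
def killFactor (s : StackState) : ℕ := (1 + (s.2.1.map Prod.snd).sum) * (s.1.length + 2) ^ 8

open Classical in
/-- One step of the machine, in which the number `a` is enumerated. -/
noncomputable def stackStep (s : StackState) (a : ℕ) : StackState :=
  (a :: s.1,
    if IsStale s then ((s.2.2.headI.2, killFactor s) :: s.2.1, s.2.2.tail)
    else if candidates s = [] then s.2
    else (s.2.1, ((candidates s).headI, s.1.length + 1) :: s.2.2))

/-- The state after the enumeration of the numbers in `l`. -/
noncomputable def stackState (l : List ℕ) : StackState := l.foldl stackStep ([], [], [])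

theorem Primrec.list_sum : Primrec (List.sum : List ℕ → ℕ) :=
  (Primrec.list_foldr Primrec.id (Primrec.const 0) (Primrec.nat_add.comp
    (Primrec.fst.comp Primrec.snd) (Primrec.snd.comp Primrec.snd)).to₂).of_eq fun l => by
      simp [List.sum_eq_foldr]

theorem primrec_killFactor : Primrec killFactor :=
  Primrec.nat_mul.comp (Primrec.nat_add.comp (Primrec.const 1) (Primrec.list_sum.comp
      (Primrec.list_map (Primrec.fst.comp Primrec.snd) (Primrec.snd.comp Primrec.snd).to₂)))
    (Primrec.nat_pow.comp (Primrec.nat_add.comp (Primrec.list_length.comp Primrec.fst)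
      (Primrec.const 2)) (Primrec.const 8))

theorem primrecRel_mem_list : PrimrecRel fun (l : List ℕ) y => y ∈ l := by
  have h : PrimrecPred fun a : (List ℕ × ℕ) × ℕ => a.2 = a.1.2 :=
    Primrec.eq.comp Primrec.snd (Primrec.snd.comp Primrec.fst)
  refine (h.exists_mem Primrec.fst).of_eq fun a => ?_
  simp

theorem primrecPred_isStale : PrimrecPred IsStale := by
  have h : PrimrecPred fun a : StackState × (ℕ × ℕ) => a.2.1 ∈ a.1.1 :=
    primrecRel_mem_list.comp (Primrec.fst.comp Primrec.fst) (Primrec.fst.comp Primrec.snd)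
  exact h.exists_mem (Primrec.snd.comp Primrec.snd)

theorem primrec_candidates : Primrec candidates := by
  classical
  refine (Primrec.list_filter_of
    (p := fun (s : StackState) y => y ∉ s.1 ∧ finsetOfCode s.2.2.headI.1 ⊂ finsetOfCode y)
    (Primrec.list_range.comp (Primrec.list_length.comp Primrec.fst)) ?_).of_eq
    fun s => by unfold candidates; congr!
  exact (primrecRel_mem_list.comp (Primrec.fst.comp Primrec.fst) Primrec.snd).not.and
    (primrecRel_finsetOfCode_ssubset.comp (Primrec.fst.comp (Primrec.list_headI.comp
      (Primrec.snd.comp (Primrec.snd.comp Primrec.fst)))) Primrec.snd)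

theorem primrec₂_stackStep : Primrec₂ stackStep := by
  classical
  have hs : Primrec fun a : StackState × ℕ => a.1 := Primrec.fst
  have h1 := Primrec.fst.comp hs
  have h2 := Primrec.fst.comp (Primrec.snd.comp hs)
  have h3 := Primrec.snd.comp (Primrec.snd.comp hs)
  have hc := primrec_candidates.comp hs
  exact Primrec.pair (Primrec.list_cons.comp Primrec.snd h1)
    (Primrec.ite (primrecPred_isStale.comp hs)
      (Primrec.pair (Primrec.list_cons.comp (Primrec.pair
        (Primrec.snd.comp (Primrec.list_headI.comp h3)) (primrec_killFactor.comp hs)) h2)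
        (Primrec.list_tail.comp h3))
      (Primrec.ite (Primrec.eq.comp hc (Primrec.const [])) (Primrec.snd.comp hs)
        (Primrec.pair h2 (Primrec.list_cons.comp (Primrec.pair (Primrec.list_headI.comp hc)
          (Primrec.succ.comp (Primrec.list_length.comp h1))) h3))))

theorem primrec_stackState : Primrec stackState :=
  Primrec.list_foldl Primrec.id (Primrec.const ([], [], []))
    (primrec₂_stackStep.comp (Primrec.fst.comp Primrec.snd) (Primrec.snd.comp Primrec.snd)).to₂

/-- The value in the space of the combination with the coefficients `δ`, at the generator `0`. -/
def total (k : List (ℕ × ℕ)) (δ : ℕ → ℚ) : ℚ := δ 0 + (k.map fun e => (e.2 : ℚ) * δ e.1).sum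

/-- The combination with the coefficients `δ` vanishes in the state `s`. -/
def Vanishes (s : StackState) (δ : ℕ → ℚ) : Prop :=
  total s.2.1 δ = 0 ∧ ∀ e ∈ s.2.2, δ e.2 = 0

theorem total_cons (e : ℕ × ℕ) (k : List (ℕ × ℕ)) (δ : ℕ → ℚ) :
    total (e :: k) δ = e.2 * δ e.1 + total k δ := by
  simp only [total, List.map_cons, List.sum_cons]
  ring

theorem total_linear (k : List (ℕ × ℕ)) (c : ℚ) (a b d : ℕ → ℚ) :
    total k (fun j => a j - c * b j - d j) = total k a - c * total k b - total k d := by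
  induction k with
  | nil => simp [total]
  | cons e k ih =>
    simp only [total_cons, ih]
    ring

theorem abs_total_le (k : List (ℕ × ℕ)) {δ : ℕ → ℚ} {B : ℚ} (h : ∀ j, |δ j| ≤ B) :
    |total k δ| ≤ B * (1 + (k.map Prod.snd).sum : ℕ) := by
  induction k with
  | nil => simpa [total] using h 0
  | cons e k ih =>
    rw [total_cons]
    calc |(e.2 : ℚ) * δ e.1 + total k δ| ≤ |(e.2 : ℚ) * δ e.1| + |total k δ| := abs_add_le _ _
      _ ≤ e.2 * B + B * (1 + (k.map Prod.snd).sum : ℕ) := by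
        rw [abs_mul, Nat.abs_cast]
        gcongr
        exact h _
      _ = B * (1 + ((e :: k).map Prod.snd).sum : ℕ) := by
        simp only [List.map_cons, List.sum_cons]
        push_cast
        ring

/-- Only a pop with `δ e.2 ≠ 0` could matter. To vanish afterwards, the old total would have to have
the absolute value `killFactor s * |δ e.2|`. With `M` for one plus the sum of the old multiples, the
total is at most `B * M`, while the product is at least `M * (s.1.length + 2) ^ 8 / B`; this
contradicts `hlt`. A push brings in a generator at which `δ` is zero. -/
theorem vanishes_stackStep_iff {s : StackState} {a : ℕ} {δ : ℕ → ℚ} {B : ℚ} (hB : 0 < B)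
    (hle : ∀ j, |δ j| ≤ B) (hge : ∀ j, δ j ≠ 0 → 1 ≤ B * |δ j|) (hnew : δ (s.1.length + 1) = 0)
    (hlt : B * B < (s.1.length + 2 : ℕ) ^ 8) : Vanishes (stackStep s a) δ ↔ Vanishes s δ := by
  classical
  simp only [Vanishes, stackStep]
  split_ifs with h1 h2
  · obtain ⟨e, S, hS⟩ : ∃ e S, s.2.2 = e :: S := by
      obtain ⟨e, he, -⟩ := h1
      exact List.exists_cons_of_ne_nil (List.ne_nil_of_mem he)
    simp only [hS, List.headI_cons, List.tail_cons, total_cons, List.forall_mem_cons]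
    by_cases he : δ e.2 = 0
    · simp [he]
    · refine iff_of_false (fun h => ?_) (fun h => he h.2.1)
      have hT := abs_total_le s.2.1 hle
      have hk : |total s.2.1 δ| = killFactor s * |δ e.2| := by
        rw [show total s.2.1 δ = -(killFactor s * δ e.2) by linarith [h.1], abs_neg, abs_mul,
          Nat.abs_cast]
      rw [hk, killFactor, Nat.cast_mul] at hT
      set M : ℚ := ((1 + (s.2.1.map Prod.snd).sum : ℕ) : ℚ) with hM
      have hM1 : 1 ≤ M := by
        rw [hM]
        exact_mod_cast Nat.le_add_right 1 _
      have h3 := hge _ he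
      push_cast at hT hlt
      have h4 : (M * ((s.1.length : ℚ) + 2) ^ 8) * |δ e.2| ≤ B * M := hT
      have h5 : ((s.1.length : ℚ) + 2) ^ 8 * |δ e.2| ≤ B := by
        refine le_of_mul_le_mul_left ?_ (lt_of_lt_of_le one_pos hM1)
        linarith
      have h6 : ((s.1.length : ℚ) + 2) ^ 8 ≤ B * B := by
        calc ((s.1.length : ℚ) + 2) ^ 8 ≤ ((s.1.length : ℚ) + 2) ^ 8 * (B * |δ e.2|) :=
              le_mul_of_one_le_right (by positivity) h3
          _ = B * (((s.1.length : ℚ) + 2) ^ 8 * |δ e.2|) := by ring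
          _ ≤ B * B := by gcongr
      linarith
  · rfl
  · simp [hnew]

/-- The coefficient with the index `j` of the formal combination with the code `x`. -/
def coef (x j : ℕ) : ℚ := scal ((Denumerable.ofNat (List ℕ) x).getD j 0)

theorem length_ofNat_le (x : ℕ) : (Denumerable.ofNat (List ℕ) x).length ≤ x := by
  have h := Encodable.length_le_encode (Denumerable.ofNat (List ℕ) x)
  rwa [Denumerable.encode_ofNat] at h

theorem getD_ofNat_le (x j : ℕ) : (Denumerable.ofNat (List ℕ) x).getD j 0 ≤ x := by
  have key : ∀ l : List ℕ, ∀ j, l.getD j 0 ≤ Encodable.encode l := by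
    intro l
    induction l with
    | nil => simp
    | cons a l ih =>
      intro j
      rw [Encodable.encode_list_cons]
      cases j with
      | zero => exact (Nat.left_le_pair _ _).trans (Nat.le_succ _)
      | succ j =>
        rw [List.getD_cons_succ]
        exact (ih j).trans ((Nat.right_le_pair _ _).trans (Nat.le_succ _))
  have h := key (Denumerable.ofNat (List ℕ) x) j
  rwa [Denumerable.encode_ofNat] at h

/-- A list is no longer than its code, so the combination `x` involves only generators with index
below `x`. -/
theorem coef_eq_zero {x j : ℕ} (h : x ≤ j) : coef x j = 0 := by
  rw [coef, List.getD_eq_default _ _ ((length_ofNat_le x).trans h), scal_zero]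

@[simp] theorem coef_zero (j : ℕ) : coef 0 j = 0 := coef_eq_zero (Nat.zero_le j)

/-- In the state `s`, the combination `z` is `c` times `x` plus `y`. -/
def IsLinear (s : StackState) (c x y z : ℕ) : Prop :=
  total s.2.1 (coef z) = scal c * total s.2.1 (coef x) + total s.2.1 (coef y) ∧
    ∀ e ∈ s.2.2, coef z e.2 = scal c * coef x e.2 + coef y e.2

theorem isLinear_iff_vanishes (s : StackState) (c x y z : ℕ) :
    IsLinear s c x y z ↔ Vanishes s fun j => coef z j - scal c * coef x j - coef y j := by
  rw [IsLinear, Vanishes, total_linear, sub_sub, sub_eq_zero]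
  simp only [sub_sub, sub_eq_zero]

/-- For codes up to `t`, the coefficients of `z - c x - y` are bounded by `(t + 1) ^ 2`, and their
denominators, products of four, by `(t + 1) ^ 4`. So `B = (t + 1) ^ 4` bounds both sizes and
inverses, and `B * B` accounts for the exponent `8` in `killFactor`. -/
theorem isLinear_stackStep_iff {s : StackState} {a t c x y z : ℕ} (hc : c ≤ t) (hx : x ≤ t)
    (hy : y ≤ t) (hz : z ≤ t) (ht : t ≤ s.1.length) :
    IsLinear (stackStep s a) c x y z ↔ IsLinear s c x y z := by
  rw [isLinear_iff_vanishes, isLinear_iff_vanishes]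
  have hT : (1 : ℚ) ≤ (t : ℚ) + 1 := by
    have : (0 : ℚ) ≤ t := Nat.cast_nonneg t
    linarith
  refine vanishes_stackStep_iff (B := ((t : ℚ) + 1) ^ 4) (by positivity) (fun j => ?_)
    (fun j hj => ?_) ?_ ?_
  · have h1 : |coef z j| ≤ t := abs_scal_le ((getD_ofNat_le z j).trans hz)
    have h2 : |coef x j| ≤ t := abs_scal_le ((getD_ofNat_le x j).trans hx)
    have h3 : |coef y j| ≤ t := abs_scal_le ((getD_ofNat_le y j).trans hy)
    have h4 : |scal c| ≤ t := abs_scal_le hc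
    have h5 : |scal c * coef x j| ≤ t * t := by
      rw [abs_mul]
      gcongr
    calc |coef z j - scal c * coef x j - coef y j|
        ≤ |coef z j - scal c * coef x j| + |coef y j| := abs_sub _ _
      _ ≤ |coef z j| + |scal c * coef x j| + |coef y j| := by gcongr; exact abs_sub _ _
      _ ≤ t + t * t + t := by gcongr
      _ ≤ ((t : ℚ) + 1) ^ 2 := by linarith [sq_nonneg ((t : ℚ) + 1)]
      _ ≤ ((t : ℚ) + 1) ^ 4 := pow_le_pow_right₀ hT (by norm_num)
  · obtain ⟨a1, d1, hd1, hl1, e1⟩ := exists_scal_eq_div ((getD_ofNat_le z j).trans hz)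
    obtain ⟨a2, d2, hd2, hl2, e2⟩ := exists_scal_eq_div hc
    obtain ⟨a3, d3, hd3, hl3, e3⟩ := exists_scal_eq_div ((getD_ofNat_le x j).trans hx)
    obtain ⟨a4, d4, hd4, hl4, e4⟩ := exists_scal_eq_div ((getD_ofNat_le y j).trans hy)
    have p1 : (0 : ℚ) < d1 := by exact_mod_cast hd1
    have p2 : (0 : ℚ) < d2 := by exact_mod_cast hd2
    have p3 : (0 : ℚ) < d3 := by exact_mod_cast hd3
    have p4 : (0 : ℚ) < d4 := by exact_mod_cast hd4
    set D : ℚ := d1 * d2 * d3 * d4 with hD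
    have hDpos : 0 < D := by positivity
    obtain ⟨N, hN⟩ : ∃ N : ℤ, D * (coef z j - scal c * coef x j - coef y j) = N := by
      refine ⟨a1 * d2 * d3 * d4 - a2 * a3 * d1 * d4 - a4 * d1 * d2 * d3, ?_⟩
      rw [coef, coef, coef, e1, e2, e3, e4, hD]
      push_cast
      field_simp
    have hDle : D ≤ ((t : ℚ) + 1) ^ 4 := by
      have q1 : (d1 : ℚ) ≤ t + 1 := by exact_mod_cast hl1
      have q2 : (d2 : ℚ) ≤ t + 1 := by exact_mod_cast hl2
      have q3 : (d3 : ℚ) ≤ t + 1 := by exact_mod_cast hl3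
      have q4 : (d4 : ℚ) ≤ t + 1 := by exact_mod_cast hl4
      calc D ≤ (t + 1) * (t + 1) * (t + 1) * (t + 1) := by rw [hD]; gcongr
        _ = ((t : ℚ) + 1) ^ 4 := by ring
    have hN0 : N ≠ 0 := by
      rintro rfl
      rw [Int.cast_zero, mul_eq_zero] at hN
      exact hN.elim hDpos.ne' hj
    have hN1 : (1 : ℚ) ≤ |(N : ℚ)| := by exact_mod_cast Int.one_le_abs hN0
    calc (1 : ℚ) ≤ |(N : ℚ)| := hN1
      _ = D * |coef z j - scal c * coef x j - coef y j| := by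
        rw [← hN, abs_mul, abs_of_pos hDpos]
      _ ≤ _ := by gcongr
  · rw [coef_eq_zero (by omega), coef_eq_zero (by omega), coef_eq_zero (by omega)]
    simp
  · rw [← pow_add]
    exact_mod_cast Nat.pow_lt_pow_left (by omega : t + 1 < s.1.length + 2) (by norm_num)

section

variable {α : Type} [Primcodable α]

theorem RatPrimrec.coef {x j : α → ℕ} (hx : Primrec x) (hj : Primrec j) :
    RatPrimrec fun a => coef (x a) (j a) :=
  RatPrimrec.scal_comp ((Primrec.list_getD 0).comp ((Primrec.ofNat (List ℕ)).comp hx) hj)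

theorem RatPrimrec.total_coef {k : α → List (ℕ × ℕ)} {x : α → ℕ} (hk : Primrec k)
    (hx : Primrec x) : RatPrimrec fun a => total (k a) (_root_.coef (x a)) :=
  (RatPrimrec.coef hx (Primrec.const 0)).add (RatPrimrec.sum_map
    (g := fun a (e : ℕ × ℕ) => (e.2 : ℚ) * _root_.coef (x a) e.1) hk
    ((RatPrimrec.natCast (Primrec.snd.comp Primrec.snd)).mul
      (RatPrimrec.coef (hx.comp Primrec.fst) (Primrec.fst.comp Primrec.snd))))

theorem PrimrecPred.isLinear {s : α → StackState} {c x y z : α → ℕ} (hs : Primrec s)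
    (hc : Primrec c) (hx : Primrec x) (hy : Primrec y) (hz : Primrec z) :
    PrimrecPred fun a => IsLinear (s a) (c a) (x a) (y a) (z a) := by
  have hk := Primrec.fst.comp (Primrec.snd.comp hs)
  have he : Primrec fun b : α × ℕ × ℕ => b.2.2 := Primrec.snd.comp Primrec.snd
  have h : PrimrecPred fun b : α × ℕ × ℕ =>
      coef (z b.1) b.2.2 = scal (c b.1) * coef (x b.1) b.2.2 + coef (y b.1) b.2.2 :=
    (RatPrimrec.coef (hz.comp Primrec.fst) he).eq
      (((RatPrimrec.scal_comp (hc.comp Primrec.fst)).mul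
        (RatPrimrec.coef (hx.comp Primrec.fst) he)).add (RatPrimrec.coef (hy.comp Primrec.fst) he))
  exact ((RatPrimrec.total_coef hk hz).eq (((RatPrimrec.scal_comp hc).mul
    (RatPrimrec.total_coef hk hx)).add (RatPrimrec.total_coef hk hy))).and
    (h.forall_mem (Primrec.snd.comp (Primrec.snd.comp hs)))

end

end StackMachine

/-! ### The limit of the stack and its maximality. -/

section Limit

/-- The state of the machine after `t` steps of the enumeration `f`. -/
noncomputable def stage (f : ℕ → ℕ) (t : ℕ) : StackState := stackState (initSeg f t)

variable {f : ℕ → ℕ}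

theorem stage_succ (f : ℕ → ℕ) (t : ℕ) : stage f (t + 1) = stackStep (stage f t) (f t) := by
  simp [stage, stackState, initSeg_succ, List.foldl_append]

theorem length_stage (f : ℕ → ℕ) (t : ℕ) : (stage f t).1.length = t := by
  induction t with
  | zero => rfl
  | succ t ih => simp [stage_succ, stackStep, ih]

theorem mem_stage {t y : ℕ} : y ∈ (stage f t).1 ↔ ∃ i < t, f i = y := by
  induction t with
  | zero => simp [stage, stackState, initSeg]
  | succ t ih =>
    simp only [stage_succ, stackStep, List.mem_cons, ih]
    constructor
    · rintro (rfl | ⟨i, hi, rfl⟩)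
      exacts [⟨t, by omega, rfl⟩, ⟨i, by omega, rfl⟩]
    · rintro ⟨i, hi, rfl⟩
      rcases Nat.lt_succ_iff_lt_or_eq.1 hi with hi | rfl
      exacts [Or.inr ⟨i, hi, rfl⟩, Or.inl rfl]

theorem mem_candidates {t y : ℕ} : y ∈ candidates (stage f t) ↔
    y < t ∧ (∀ i < t, f i ≠ y) ∧ finsetOfCode (stage f t).2.2.headI.1 ⊂ finsetOfCode y := by
  simp [candidates, length_stage, mem_stage]

/-- The three moves are pop, wait and push. A pop removes the top even if the enumerated set lies
deeper in the stack. -/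
theorem stage_succ_cases (f : ℕ → ℕ) (t : ℕ) :
    (IsStale (stage f t) ∧ ∃ e g, (stage f t).2.2 = e :: (stage f (t + 1)).2.2 ∧
      (stage f (t + 1)).2.1 = (e.2, g) :: (stage f t).2.1) ∨
    (¬ IsStale (stage f t) ∧ candidates (stage f t) = [] ∧ (stage f (t + 1)).2 = (stage f t).2) ∨
    (¬ IsStale (stage f t) ∧ ∃ y l, candidates (stage f t) = y :: l ∧
      (stage f (t + 1)).2 = ((stage f t).2.1, (y, t + 1) :: (stage f t).2.2)) := by
  rw [stage_succ]
  simp only [stackStep]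
  split_ifs with h1 h2
  · refine Or.inl ⟨h1, ?_⟩
    obtain ⟨e, he, -⟩ := h1
    obtain ⟨e, S, hS⟩ := List.exists_cons_of_ne_nil (List.ne_nil_of_mem he)
    exact ⟨e, _, by simp [hS], by simp only [hS, List.headI_cons]; rfl⟩
  · exact Or.inr (Or.inl ⟨h1, h2, rfl⟩)
  · obtain ⟨y, l, hy⟩ := List.exists_cons_of_ne_nil h2
    exact Or.inr (Or.inr ⟨h1, y, l, hy, by simp [hy, length_stage]⟩)

theorem stack_pairwise (f : ℕ → ℕ) (t : ℕ) :
    ((stage f t).2.2.Pairwise fun a b => finsetOfCode b.1 ⊂ finsetOfCode a.1 ∧ b.2 < a.2) ∧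
    ∀ e ∈ (stage f t).2.2, (finsetOfCode e.1).Nonempty ∧ 0 < e.2 ∧ e.2 ≤ t := by
  induction t with
  | zero => simp [stage, stackState, initSeg]
  | succ t ih =>
    obtain ⟨ih1, ih2⟩ := ih
    rcases stage_succ_cases f t with ⟨-, e, g, he, -⟩ | ⟨-, -, h⟩ | ⟨-, y, l, hy, h⟩
    · rw [he] at ih1 ih2
      refine ⟨ih1.of_cons, fun e' he' => ?_⟩
      obtain ⟨h1, h2, h3⟩ := ih2 e' (List.mem_cons_of_mem _ he')
      exact ⟨h1, h2, by omega⟩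
    · rw [h]
      refine ⟨ih1, fun e' he' => ?_⟩
      obtain ⟨h1, h2, h3⟩ := ih2 e' he'
      exact ⟨h1, h2, by omega⟩
    · rw [h]
      have hyc : y ∈ candidates (stage f t) := by simp [hy]
      obtain ⟨-, -, hyt⟩ := mem_candidates.1 hyc
      refine ⟨List.pairwise_cons.2 ⟨fun e' he' => ⟨?_, ?_⟩, ih1⟩, ?_⟩
      · refine lt_of_le_of_lt ?_ hyt
        generalize (stage f t).2.2 = S at ih1 he'
        cases S with
        | nil => simp at he'
        | cons a S =>
          rcases List.mem_cons.1 he' with rfl | he'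
          · exact le_rfl
          · exact (List.rel_of_pairwise_cons ih1 he').1.1
      · have := (ih2 e' he').2.2
        omega
      · rw [List.forall_mem_cons]
        refine ⟨⟨?_, by omega, le_rfl⟩, fun e' he' => ?_⟩
        · obtain ⟨i, hi, -⟩ := Finset.exists_of_ssubset hyt
          exact ⟨i, hi⟩
        · obtain ⟨h1, h2, h3⟩ := ih2 e' he'
          exact ⟨h1, h2, by omega⟩

theorem killed_disjoint (f : ℕ → ℕ) (t : ℕ) :
    ∀ d ∈ (stage f t).2.1, 0 < d.1 ∧ d.1 ≤ t ∧ ∀ e ∈ (stage f t).2.2, e.2 ≠ d.1 := by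
  induction t with
  | zero => simp [stage, stackState, initSeg]
  | succ t ih =>
    rcases stage_succ_cases f t with ⟨-, e, g, he, hk⟩ | ⟨-, -, h⟩ | ⟨-, y, l, hy, h⟩
    · have hp := stack_pairwise f t
      rw [he] at hp ih
      rw [hk, List.forall_mem_cons]
      obtain ⟨-, h1, h2⟩ := hp.2 e List.mem_cons_self
      refine ⟨⟨h1, by simpa using h2.trans (Nat.le_succ t), fun e' he' => ?_⟩, fun d hd => ?_⟩
      · exact (List.rel_of_pairwise_cons hp.1 he').2.ne
      · obtain ⟨h3, h4, h5⟩ := ih d hd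
        exact ⟨h3, by omega, fun e' he' => h5 e' (List.mem_cons_of_mem _ he')⟩
    · rw [h]
      intro d hd
      obtain ⟨h3, h4, h5⟩ := ih d hd
      exact ⟨h3, by omega, h5⟩
    · rw [h]
      intro d hd
      obtain ⟨h3, h4, h5⟩ := ih d hd
      refine ⟨h3, by omega, ?_⟩
      rw [List.forall_mem_cons]
      exact ⟨by simp only; omega, h5⟩

/-- `F` is the bottom of the stack from some time on. -/
def IsPermanent (f : ℕ → ℕ) (F : List (ℕ × ℕ)) : Prop :=
  ∃ T, ∀ t ≥ T, F <:+ (stage f t).2.2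

/-- If a permanent set were enumerated, the stack would be stale from then on and lose an entry at
every step. -/
theorem IsPermanent.notMem_range {F : List (ℕ × ℕ)} (hF : IsPermanent f F) {e : ℕ × ℕ}
    (he : e ∈ F) : e.1 ∉ Set.range f := by
  rintro ⟨i, hi⟩
  obtain ⟨T, hT⟩ := hF
  set N := max T (i + 1) with hN
  have hmem : ∀ t ≥ N, e ∈ (stage f t).2.2 := fun t ht =>
    (hT t ((le_max_left _ _).trans ht)).subset he
  have hstale : ∀ t ≥ N, IsStale (stage f t) := fun t ht =>
    ⟨e, hmem t ht, mem_stage.2 ⟨i, by have := le_max_right T (i + 1); omega, hi⟩⟩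
  have hlen : ∀ m, (stage f (N + m)).2.2.length + m = (stage f N).2.2.length := by
    intro m
    induction m with
    | zero => rfl
    | succ m ih =>
      have hs := hstale (N + m) (by omega)
      rcases stage_succ_cases f (N + m) with ⟨-, e, g, he, -⟩ | ⟨h, -⟩ | ⟨h, -⟩
      · rw [he, List.length_cons] at ih
        change (stage f (N + m + 1)).2.2.length + (m + 1) = _
        omega
      all_goals exact absurd hs h
  have := hlen ((stage f N).2.2.length + 1)
  omega

theorem length_le_card_of_pairwise {F : List (ℕ × ℕ)}
    (hF : F.Pairwise fun a b => finsetOfCode b.1 ⊂ finsetOfCode a.1 ∧ b.2 < a.2)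
    (hne : ∀ e ∈ F, (finsetOfCode e.1).Nonempty) : F.length ≤ (finsetOfCode F.headI.1).card := by
  induction F with
  | nil => simp
  | cons e F ih =>
    have ih' := ih hF.of_cons fun e' he' => hne e' (List.mem_cons_of_mem _ he')
    cases F with
    | nil => simpa [Nat.one_le_iff_ne_zero] using (hne e List.mem_cons_self).ne_empty
    | cons e' F =>
      have h := Finset.card_lt_card (List.rel_of_pairwise_cons hF List.mem_cons_self).1
      simp only [List.headI_cons, List.length_cons] at ih' ⊢
      omega

theorem IsPermanent.pairwise {F : List (ℕ × ℕ)} (hF : IsPermanent f F) :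
    (F.Pairwise fun a b => finsetOfCode b.1 ⊂ finsetOfCode a.1 ∧ b.2 < a.2) ∧
    ∀ e ∈ F, (finsetOfCode e.1).Nonempty ∧ 0 < e.2 := by
  obtain ⟨T, hT⟩ := hF
  have hs := hT T le_rfl
  obtain ⟨h1, h2⟩ := stack_pairwise f T
  exact ⟨h1.sublist hs.sublist, fun e he => ⟨(h2 e (hs.subset he)).1, (h2 e (hs.subset he)).2.1⟩⟩

theorem IsPermanent.headI_notMem_range (h0 : 0 ∉ Set.range f) {F : List (ℕ × ℕ)}
    (hF : IsPermanent f F) : F.headI.1 ∉ Set.range f := by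
  cases F with
  | nil => exact h0
  | cons e F => exact hF.notMem_range List.mem_cons_self

/-- In a strict chain of nonempty sets the top has at least as many elements as the chain has
members; since it is not enumerated, it has fewer than `n`. -/
theorem IsPermanent.length_lt (h0 : 0 ∉ Set.range f) {n : ℕ}
    (hn : ∀ y, n ≤ (finsetOfCode y).card → y ∈ Set.range f) {F : List (ℕ × ℕ)}
    (hF : IsPermanent f F) : F.length < n := by
  by_contra hle
  push Not at hle
  refine hF.headI_notMem_range h0 (hn _ (hle.trans ?_))
  exact length_le_card_of_pairwise hF.pairwise.1 fun e he => (hF.pairwise.2 e he).1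

/-- `F` is the limit of the stack: a permanent bottom part that has the maximal length. -/
def IsLimitStack (f : ℕ → ℕ) (F : List (ℕ × ℕ)) : Prop :=
  IsPermanent f F ∧ ∀ G, IsPermanent f G → G.length ≤ F.length

theorem exists_isLimitStack (h0 : 0 ∉ Set.range f) {n : ℕ}
    (hn : ∀ y, n ≤ (finsetOfCode y).card → y ∈ Set.range f) : ∃ F, IsLimitStack f F := by
  classical
  let P : ℕ → Prop := fun m => ∃ F, IsPermanent f F ∧ F.length = m
  have hP0 : P 0 := ⟨[], ⟨0, fun _ _ => List.nil_suffix⟩, rfl⟩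
  obtain ⟨F, hF, hlen⟩ := Nat.findGreatest_spec (P := P) (Nat.zero_le n) hP0
  refine ⟨F, hF, fun G hG => ?_⟩
  rw [hlen]
  exact Nat.le_findGreatest (hG.length_lt h0 hn).le ⟨G, hG, rfl⟩

/-- Otherwise the entry just above `F` would never be popped again, and together with `F` it would
form a longer permanent part. -/
theorem IsLimitStack.exists_stage_eq {F : List (ℕ × ℕ)} (hF : IsLimitStack f F) (N : ℕ) :
    ∃ t ≥ N, (stage f t).2.2 = F := by
  obtain ⟨⟨T, hT⟩, hmax⟩ := hF
  by_contra hne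
  push Not at hne
  set M := max T N with hM
  have hTM : T ≤ M := le_max_left _ _
  have hNM : N ≤ M := le_max_right _ _
  obtain ⟨G, hG⟩ := hT M hTM
  have hG0 : G ≠ [] := fun h => hne M hNM (by rw [← hG, h, List.nil_append])
  obtain ⟨G', a, rfl⟩ : ∃ G' a, G = G' ++ [a] :=
    ⟨G.dropLast, G.getLast hG0, (List.dropLast_append_getLast hG0).symm⟩
  have hperm : ∀ t ≥ M, (a :: F) <:+ (stage f t).2.2 := by
    intro t ht
    induction t, ht using Nat.le_induction with
    | base => exact ⟨G', by simpa using hG⟩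
    | succ t ht ih =>
      rcases stage_succ_cases f t with ⟨-, e, g, he, -⟩ | ⟨-, -, h⟩ | ⟨-, y, l, hy, h⟩
      · rw [he] at ih
        rcases List.suffix_cons_iff.1 ih with heq | h
        · exact absurd (List.cons.inj heq).2.symm (hne (t + 1) (by omega))
        · exact h
      · rwa [h]
      · rw [h]
        exact ih.trans (List.suffix_cons _ _)
  have := hmax (a :: F) ⟨M, hperm⟩
  simp at this

/-- Consider a counterexample `y` with the least code, at a stage when the stack is exactly `F` and
all supersets with smaller codes have been enumerated. Then `y` is the first candidate and is
pushed. As no set of the new stack is ever enumerated, it stays forever, against the maximality of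
`F`. -/
theorem IsLimitStack.mem_range_of_ssubset {F : List (ℕ × ℕ)}
    (hF : IsLimitStack f F) {y : ℕ} (hy : finsetOfCode F.headI.1 ⊂ finsetOfCode y) :
    y ∈ Set.range f := by
  classical
  induction y using Nat.strong_induction_on with
  | _ y ih =>
  by_contra hyf
  have ih' : ∀ y', ∃ N, y' < y → finsetOfCode F.headI.1 ⊂ finsetOfCode y' →
      ∃ i < N, f i = y' := fun y' => by
    by_cases h : y' < y ∧ finsetOfCode F.headI.1 ⊂ finsetOfCode y'
    · obtain ⟨i, hi⟩ := ih y' h.1 h.2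
      exact ⟨i + 1, fun _ _ => ⟨i, by omega, hi⟩⟩
    · exact ⟨0, fun h1 h2 => absurd ⟨h1, h2⟩ h⟩
  choose N hN using ih'
  obtain ⟨t, ht, hst⟩ := hF.exists_stage_eq (max ((Finset.range y).sup N) (y + 1))
  have hperm := hF.1
  have hnotmem : ∀ e ∈ (y, t + 1) :: F, e.1 ∉ Set.range f := by
    rw [List.forall_mem_cons]
    exact ⟨hyf, fun e he => hperm.notMem_range he⟩
  have hstale : ¬ IsStale (stage f t) := by
    rintro ⟨e, he, hE⟩
    rw [hst] at he
    obtain ⟨i, -, hi⟩ := mem_stage.1 hE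
    exact hperm.notMem_range he ⟨i, hi⟩
  have hyc : y ∈ candidates (stage f t) := by
    rw [mem_candidates, hst]
    exact ⟨by have := le_max_right ((Finset.range y).sup N) (y + 1); omega,
      fun i _ hi => hyf ⟨i, hi⟩, hy⟩
  have hhead : ∀ z l, candidates (stage f t) = z :: l → z = y := by
    intro z l hz
    have hsorted : (candidates (stage f t)).Pairwise (· < ·) :=
      List.pairwise_lt_range.filter _
    have hzc : z ∈ candidates (stage f t) := by simp [hz]
    rw [hz] at hyc hsorted
    rcases List.mem_cons.1 hyc with h | h
    · exact h.symm
    · have hzy := List.rel_of_pairwise_cons hsorted h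
      obtain ⟨-, hz1, hz2⟩ := mem_candidates.1 hzc
      rw [hst] at hz2
      obtain ⟨i, hi, hfi⟩ := hN z hzy hz2
      have h3 : N z ≤ (Finset.range y).sup N := Finset.le_sup (by simpa using hzy)
      have h4 := le_max_left ((Finset.range y).sup N) (y + 1)
      exact absurd hfi (hz1 i (by omega))
  have hnext : (stage f (t + 1)).2.2 = (y, t + 1) :: F := by
    rcases stage_succ_cases f t with ⟨h, -⟩ | ⟨-, h, -⟩ | ⟨-, z, l, hz, h⟩
    · exact absurd h hstale
    · simp [h] at hyc
    · rw [h, hst, hhead z l hz]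
  have hperm' : ∀ t' ≥ t + 1, ((y, t + 1) :: F) <:+ (stage f t').2.2 := by
    intro t' ht'
    induction t', ht' using Nat.le_induction with
    | base => rw [hnext]
    | succ t' ht' ih =>
      rcases stage_succ_cases f t' with ⟨hs, e, g, he, -⟩ | ⟨-, -, h⟩ | ⟨-, z, l, hz, h⟩
      · rw [he] at ih
        rcases List.suffix_cons_iff.1 ih with heq | h
        · obtain ⟨e', he', hE⟩ := hs
          rw [he, ← heq] at he'
          obtain ⟨i, -, hi⟩ := mem_stage.1 hE
          exact absurd ⟨i, hi⟩ (hnotmem e' he')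
        · exact h
      · rwa [h]
      · rw [h]
        exact ih.trans (List.suffix_cons _ _)
  have := hF.2 _ ⟨t + 1, hperm'⟩
  simp at this

/-- A part of the stack has been there since the creation of its top generator. -/
theorem suffix_stage_of_le {F : List (ℕ × ℕ)} {t t' : ℕ} (h : F <:+ (stage f t).2.2)
    (ht : t' ≤ t) (hF : F ≠ [] → F.headI.2 ≤ t') : F <:+ (stage f t').2.2 := by
  induction t, ht using Nat.le_induction with
  | base => exact h
  | succ t ht ih =>
    apply ih
    rcases stage_succ_cases f t with ⟨hs, e, g, he, -⟩ | ⟨-, -, h'⟩ | ⟨-, z, l, hz, h'⟩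
    · rw [he]
      exact h.trans (List.suffix_cons _ _)
    · rwa [h'] at h
    · rw [h'] at h
      rcases List.suffix_cons_iff.1 h with heq | h
      · have := hF (by simp [heq])
        rw [heq, List.headI_cons] at this
        omega
      · exact h

/-- Once the stack has its limit value, the killings do not concern combinations with smaller
codes. -/
theorem total_stage_eq {F : List (ℕ × ℕ)} {t₀ t x : ℕ} (hF : ∀ t ≥ t₀, F <:+ (stage f t).2.2)
    (h₀ : (stage f t₀).2.2 = F) (hx : x ≤ t₀) (ht : t₀ ≤ t) :
    total (stage f t).2.1 (coef x) = total (stage f t₀).2.1 (coef x) := by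
  -- The invariant: whatever lies above `F` was created after stage `t₀`, so `x` has coefficient
  -- zero at every generator killed from now on.
  suffices h : (∃ G, (stage f t).2.2 = G ++ F ∧ ∀ e ∈ G, t₀ < e.2) ∧
      total (stage f t).2.1 (coef x) = total (stage f t₀).2.1 (coef x) from h.2
  induction t, ht using Nat.le_induction with
  | base => exact ⟨⟨[], by simp [h₀]⟩, rfl⟩
  | succ t ht ih =>
    obtain ⟨⟨G, hG, hGt⟩, ih⟩ := ih
    rcases stage_succ_cases f t with ⟨hs, e, g, he, hk⟩ | ⟨-, -, h⟩ | ⟨-, z, l, hz, h⟩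
    · cases G with
      | nil =>
        have h1 := (hF (t + 1) (by omega)).length_le
        rw [he, List.nil_append] at hG
        rw [← hG, List.length_cons] at h1
        omega
      | cons a G =>
        rw [he, List.cons_append] at hG
        obtain ⟨rfl, hG'⟩ := List.cons.inj hG
        refine ⟨⟨G, hG', fun e' he' => hGt e' (List.mem_cons_of_mem _ he')⟩, ?_⟩
        have := hGt e List.mem_cons_self
        rw [hk, total_cons, coef_eq_zero (by simp only; omega), mul_zero, zero_add, ih]
    · rw [h]
      exact ⟨⟨G, hG, hGt⟩, ih⟩
    · rw [h]
      refine ⟨⟨(z, t + 1) :: G, by simp [hG], ?_⟩, ih⟩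
      rw [List.forall_mem_cons]
      exact ⟨by simp only; omega, hGt⟩

theorem isLinear_stage_iff {c x y z t₀ t : ℕ} (hc : c ≤ t₀) (hx : x ≤ t₀) (hy : y ≤ t₀)
    (hz : z ≤ t₀) (ht : t₀ ≤ t) :
    IsLinear (stage f t) c x y z ↔ IsLinear (stage f t₀) c x y z := by
  induction t, ht using Nat.le_induction with
  | base => rfl
  | succ t ht ih =>
    rw [stage_succ, isLinear_stackStep_iff hc hx hy hz (by rwa [length_stage]), ih]

end Limit

/-! ### The limit space, the codes of its vectors, and its name. -/

section LimitSpace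

variable {f : ℕ → ℕ} {F : List (ℕ × ℕ)}

/-- The formal combinations present the space `ℚ × (Fin F.length → ℚ)`. -/
theorem IsLimitStack.exists_eval (hF : IsLimitStack f F) :
    ∃ E : ℕ → ℚ × (Fin F.length → ℚ), Function.Surjective E ∧
      (∀ x i, (E x).2 i = coef x (F.get i).2) ∧
      ∀ c x y z t, c ≤ t → x ≤ t → y ≤ t → z ≤ t →
        (IsLinear (stage f t) c x y z ↔ E z = scal c • E x + E y) := by
  classical
  obtain ⟨T, hT⟩ := hF.1
  -- At a stage where the stack is exactly `F`, the total of `x` has reached its final value.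
  have hτ : ∀ x, ∃ t, T ≤ t ∧ x ≤ t ∧ (stage f t).2.2 = F := fun x => by
    obtain ⟨t, ht, h⟩ := hF.exists_stage_eq (max T x)
    exact ⟨t, (le_max_left _ _).trans ht, (le_max_right _ _).trans ht, h⟩
  choose τ hτT hτx hτF using hτ
  have htotal : ∀ x t, x ≤ t → T ≤ t → (stage f t).2.2 = F →
      total (stage f t).2.1 (coef x) = total (stage f (τ x)).2.1 (coef x) := by
    intro x t hxt hTt hst
    rcases le_total (τ x) t with h | h
    · exact total_stage_eq (fun s hs => hT s ((hτT x).trans hs)) (hτF x) (hτx x) h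
    · exact (total_stage_eq (fun s hs => hT s (hTt.trans hs)) hst hxt h).symm
  refine ⟨fun x => (total (stage f (τ x)).2.1 (coef x), fun i => coef x (F.get i).2), ?_,
    fun x i => rfl, ?_⟩
  · rintro ⟨a, b⟩
    have hpw := hF.1.pairwise
    -- The coefficients are zero off `0` and the generators in `F`, so the killed generators
    -- contribute nothing to the total.
    let g : ℕ → ℚ := fun j =>
      if j = 0 then a else if h : ∃ i, (F.get i).2 = j then b h.choose else 0
    have hinj : ∀ i j, (F.get i).2 = (F.get j).2 → i = j := by
      intro i j hij
      rcases lt_trichotomy i j with h | h | h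
      · exact absurd hij (List.pairwise_iff_get.1 hpw.1 i j h).2.ne'
      · exact h
      · exact absurd hij (List.pairwise_iff_get.1 hpw.1 j i h).2.ne
    have hpos : ∀ i, (F.get i).2 ≠ 0 := fun i => (hpw.2 _ (List.get_mem F i)).2.ne'
    have hgF : ∀ i, g (F.get i).2 = b i := fun i => by
      have h : ∃ i', (F.get i').2 = (F.get i).2 := ⟨i, rfl⟩
      simp only [g, if_neg (hpos i), dif_pos h]
      rw [hinj _ _ h.choose_spec]
    set N := (F.map Prod.snd).sum + 1 with hN
    set x := Encodable.encode ((List.range N).map fun j => ratCode (g j)) with hx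
    have hcoef : ∀ j, coef x j = if j < N then g j else 0 := by
      intro j
      rw [coef, hx, Denumerable.ofNat_encode]
      by_cases hj : j < N <;> simp [hj]
    have hFN : ∀ i, (F.get i).2 < N := fun i => by
      rw [hN, Nat.lt_succ_iff]
      exact List.single_le_sum (by simp) _ (List.mem_map_of_mem (List.get_mem F i))
    refine ⟨x, Prod.ext ?_ (funext fun i => ?_)⟩
    · have hsum : (((stage f (τ x)).2.1).map fun e => (e.2 : ℚ) * coef x e.1).sum = 0 := by
        apply List.sum_eq_zero
        intro r hr
        obtain ⟨d, hd, rfl⟩ := List.mem_map.1 hr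
        obtain ⟨h1, -, h2⟩ := killed_disjoint f (τ x) d hd
        rw [hτF] at h2
        have : g d.1 = 0 := by
          have hne : ¬ ∃ i, (F.get i).2 = d.1 := fun ⟨i, hi⟩ => h2 _ (List.get_mem F i) hi
          simp only [g, if_neg h1.ne', dif_neg hne]
        rw [hcoef, this, ite_self, mul_zero]
      simp only [total, hsum, add_zero]
      simp [hcoef, hN, g]
    · simp only [hcoef, if_pos (hFN i), hgF]
  · intro c x y z t hc hx hy hz
    obtain ⟨s, hs, hsF⟩ := hF.exists_stage_eq (max T t)
    have hTs : T ≤ s := (le_max_left _ _).trans hs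
    have hts : t ≤ s := (le_max_right _ _).trans hs
    rw [← isLinear_stage_iff hc hx hy hz hts, IsLinear, htotal x s (hx.trans hts) hTs hsF,
      htotal y s (hy.trans hts) hTs hsF, htotal z s (hz.trans hts) hTs hsF, hsF, Prod.ext_iff,
      funext_iff]
    refine and_congr Iff.rfl ⟨fun h i => h _ (List.get_mem F i), fun h e he => ?_⟩
    obtain ⟨i, rfl⟩ := List.get_of_mem he
    exact h i

/-- The code of the vector given by the formal combination `x`: it contains the part of the
enumeration `f` that was known when `x` was introduced. -/
def historyCode (f : ℕ → ℕ) (x : ℕ) : ℕ := Nat.pair (Encodable.encode (initSeg f x)) x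

theorem encode_le_encode_append (l m : List ℕ) :
    Encodable.encode l ≤ Encodable.encode (l ++ m) := by
  induction l with
  | nil => simp
  | cons a l ih =>
    rw [List.cons_append, Encodable.encode_list_cons, Encodable.encode_list_cons]
    rcases ih.eq_or_lt with h | h
    · rw [h]
    · exact Nat.succ_le_succ (Nat.pair_lt_pair_right _ h).le

/-- Hence the largest code in a basis carries the longest history. -/
theorem historyCode_strictMono (f : ℕ → ℕ) : StrictMono (historyCode f) := by
  refine strictMono_nat_of_lt_succ fun x => ?_
  rw [historyCode, historyCode, initSeg_succ]
  refine (Nat.pair_lt_pair_right _ (Nat.lt_succ_self x)).trans_le ?_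
  rcases (encode_le_encode_append (initSeg f x) [f x]).eq_or_lt with h | h
  · rw [h]
  · exact (Nat.pair_lt_pair_left _ h).le

/-- When `l` has been enumerated, `z` is the code of the vector `c • x + y`. -/
def IsCode (l : List ℕ) (c x y z : ℕ) : Prop :=
  z.unpair.1 = Encodable.encode (l.take z.unpair.2) ∧
  IsLinear (stackState l) c x y z.unpair.2 ∧
  ∀ w < z.unpair.2, ¬ IsLinear (stackState l) c x y w

theorem PrimrecPred.isCode {α : Type} [Primcodable α] {l : α → List ℕ} {c x y z : α → ℕ}
    (hl : Primrec l) (hc : Primrec c) (hx : Primrec x) (hy : Primrec y) (hz : Primrec z) :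
    PrimrecPred fun a => IsCode (l a) (c a) (x a) (y a) (z a) := by
  have hu := Primrec.unpair.comp hz
  have hs := primrec_stackState.comp hl
  have h : PrimrecPred fun b : α × ℕ => ¬ IsLinear (stackState (l b.1)) (c b.1) (x b.1) (y b.1) b.2 :=
    (PrimrecPred.isLinear (hs.comp Primrec.fst) (hc.comp Primrec.fst) (hx.comp Primrec.fst)
      (hy.comp Primrec.fst) Primrec.snd).not
  exact (Primrec.eq.comp (Primrec.fst.comp hu) (Primrec.encode.comp
    (Primrec.list_take.comp (Primrec.snd.comp hu) hl))).and
    ((PrimrecPred.isLinear hs hc hx hy (Primrec.snd.comp hu)).and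
      (h.forall_lt_of (Primrec.snd.comp hu)))

open Classical in
/-- The code of a vector, for a surjection `E` from the formal combinations onto the vectors. -/
noncomputable def vectorCode {V : Type} (f : ℕ → ℕ) (E : ℕ → V) (hE : Function.Surjective E)
    (v : V) : ℕ :=
  historyCode f (Nat.find (hE v))

section

variable {V : Type} {E : ℕ → V} (hE : Function.Surjective E)

theorem vectorCode_eq (f : ℕ → ℕ) (v : V) :
    vectorCode f E hE v = historyCode f (vectorCode f E hE v).unpair.2 := by
  simp [vectorCode, historyCode]

theorem eval_vectorCode (f : ℕ → ℕ) (v : V) : E (vectorCode f E hE v).unpair.2 = v := by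
  classical
  simpa [vectorCode, historyCode] using Nat.find_spec (hE v)

theorem vectorCode_injective (f : ℕ → ℕ) : Function.Injective (vectorCode f E hE) := fun v w h => by
  rw [← eval_vectorCode hE f v, h, eval_vectorCode hE]

theorem eq_vectorCode_iff (f : ℕ → ℕ) (v : V) (z : ℕ) : z = vectorCode f E hE v ↔
    z.unpair.1 = Encodable.encode (initSeg f z.unpair.2) ∧ E z.unpair.2 = v ∧
      ∀ w < z.unpair.2, E w ≠ v := by
  classical
  constructor
  · rintro rfl
    refine ⟨?_, eval_vectorCode hE f v, ?_⟩
    · simp [vectorCode, historyCode]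
    · intro w hw
      simp only [vectorCode, historyCode, Nat.unpair_pair] at hw
      exact Nat.find_min (hE v) hw
  · rintro ⟨h1, h2, h3⟩
    rw [vectorCode, (Nat.find_eq_iff (hE v)).2 ⟨h2, h3⟩, historyCode, ← h1, Nat.pair_unpair]

end

/-- Minimality of a code concerns only combinations below `z.unpair.2`, whose relations are settled
by stage `t`. -/
theorem isCode_iff {V : Type} [AddCommGroup V] [Module ℚ V] {E : ℕ → V}
    (hE : Function.Surjective E)
    (hlin : ∀ c x y z t, c ≤ t → x ≤ t → y ≤ t → z ≤ t →
        (IsLinear (stage f t) c x y z ↔ E z = scal c • E x + E y))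
    {c x y z t : ℕ} (hc : c ≤ t) (hx : x ≤ t) (hy : y ≤ t) (hz : z ≤ t) :
    IsCode (initSeg f t) c x y z ↔ z = vectorCode f E hE (scal c • E x + E y) := by
  have hz2 : z.unpair.2 ≤ t := (Nat.unpair_right_le z).trans hz
  rw [eq_vectorCode_iff, IsCode, take_initSeg f hz2]
  refine and_congr Iff.rfl (and_congr (hlin _ _ _ _ _ hc hx hy hz2) ?_)
  exact forall₂_congr fun w hw => not_congr (hlin _ _ _ _ _ hc hx hy (hw.le.trans hz2))

/-- The relation `z = q m` for the name `q` of the space, in terms of an initial segment `l` of the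
instance of `C^⊂_max`. -/
def NameRel (l : List ℕ) (m z : ℕ) : Prop :=
  (m.unpair.1 = 0 → z = l.headI + 1) ∧
  (m.unpair.1 = 1 → (z = 1 ∧ ratCode (scal m.unpair.2) = m.unpair.2 ∨
    z = 0 ∧ ¬ ratCode (scal m.unpair.2) = m.unpair.2)) ∧
  (m.unpair.1 = 2 → z = ratCode m.unpair.2) ∧
  (m.unpair.1 = 3 → z = ratCode (scal m.unpair.2.unpair.1 + scal m.unpair.2.unpair.2)) ∧
  (m.unpair.1 = 4 → z = ratCode (scal m.unpair.2.unpair.1 * scal m.unpair.2.unpair.2)) ∧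
  (m.unpair.1 = 5 → (z = 1 ∧ IsCode l.tail 7 m.unpair.2.unpair.2 0 m.unpair.2 ∨
    z = 0 ∧ ¬ IsCode l.tail 7 m.unpair.2.unpair.2 0 m.unpair.2)) ∧
  (m.unpair.1 = 6 → IsCode l.tail 0 0 0 z) ∧
  (m.unpair.1 = 7 →
    IsCode l.tail 7 m.unpair.2.unpair.1.unpair.2 m.unpair.2.unpair.2.unpair.2 z) ∧
  (8 ≤ m.unpair.1 → IsCode l.tail m.unpair.2.unpair.1 m.unpair.2.unpair.2.unpair.2 0 z)

theorem primrecPred_nameRel : PrimrecPred fun a : (List ℕ × ℕ) × ℕ => NameRel a.1.1 a.1.2 a.2 := by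
  have hl : Primrec fun a : (List ℕ × ℕ) × ℕ => a.1.1 := Primrec.fst.comp Primrec.fst
  have ht := Primrec.list_tail.comp hl
  have hz : Primrec fun a : (List ℕ × ℕ) × ℕ => a.2 := Primrec.snd
  have hu := Primrec.unpair.comp
    (Primrec.snd.comp (Primrec.fst (α := List ℕ × ℕ) (β := ℕ)))
  have hi := Primrec.fst.comp hu
  have hx := Primrec.snd.comp hu
  have ha := Primrec.fst.comp (Primrec.unpair.comp hx)
  have hb := Primrec.snd.comp (Primrec.unpair.comp hx)
  have ha2 := Primrec.snd.comp (Primrec.unpair.comp ha)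
  have hb2 := Primrec.snd.comp (Primrec.unpair.comp hb)
  have heq : ∀ k, PrimrecPred fun a : (List ℕ × ℕ) × ℕ => a.1.2.unpair.1 = k := fun k =>
    Primrec.eq.comp hi (Primrec.const k)
  have hz1 := Primrec.eq.comp hz (Primrec.const 1)
  have hz0 := Primrec.eq.comp hz (Primrec.const 0)
  have h1 := Primrec.eq.comp (RatPrimrec.scal_comp hx) hx
  have h5 := PrimrecPred.isCode ht (Primrec.const 7) hb (Primrec.const 0) hx
  refine ((heq 0).imp (Primrec.eq.comp hz (Primrec.succ.comp (Primrec.list_headI.comp hl)))).and <|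
    ((heq 1).imp ((hz1.and h1).or (hz0.and h1.not))).and <|
    ((heq 2).imp (Primrec.eq.comp hz (RatPrimrec.natCast hx))).and <|
    ((heq 3).imp (Primrec.eq.comp hz
      ((RatPrimrec.scal_comp ha).add (RatPrimrec.scal_comp hb)))).and <|
    ((heq 4).imp (Primrec.eq.comp hz
      ((RatPrimrec.scal_comp ha).mul (RatPrimrec.scal_comp hb)))).and <|
    ((heq 5).imp ((hz1.and h5).or (hz0.and h5.not))).and <|
    ((heq 6).imp (PrimrecPred.isCode ht (Primrec.const 0) (Primrec.const 0) (Primrec.const 0) hz)).and <|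
    ((heq 7).imp (PrimrecPred.isCode ht (Primrec.const 7) ha2 hb2 hz)).and
    ((Primrec.nat_le.comp (Primrec.const 8) hi).imp
      (PrimrecPred.isCode ht ha hb2 (Primrec.const 0) hz))

open Classical in
/-- The name of the vector space `V` that is presented by `E`. -/
noncomputable def spaceName {V : Type} [AddCommGroup V] [Module ℚ V] (n : ℕ) (E : ℕ → V)
    (ν : V → ℕ) (m : ℕ) : ℕ :=
  let x := m.unpair.2
  match m.unpair.1 with
  | 0 => n + 1
  | 1 => if x ∈ Set.range ratCode then 1 else 0
  | 2 => ratCode x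
  | 3 => ratCode (scal x.unpair.1 + scal x.unpair.2)
  | 4 => ratCode (scal x.unpair.1 * scal x.unpair.2)
  | 5 => if x ∈ Set.range ν then 1 else 0
  | 6 => ν 0
  | 7 => ν (E x.unpair.1.unpair.2 + E x.unpair.2.unpair.2)
  | _ => ν (scal x.unpair.1 • E x.unpair.2.unpair.2)

theorem isVectorSpaceName_spaceName {V : Type} [AddCommGroup V] [Module ℚ V] (n : ℕ) {E : ℕ → V}
    {ν : V → ℕ} (hν : Function.Injective ν) (hE : ∀ v, E (ν v).unpair.2 = v) :
    IsVectorSpaceName (spaceName n E ν) ratCode ν where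
  injective_scalar := ratCode_injective
  injective_vector := hν
  scalars x := by simp [component, spaceName]
  scalar_zero := by simp [component, spaceName]
  scalar_one := by simp [component, spaceName]
  scalar_add a b := by simp [component, spaceName]
  scalar_mul a b := by simp [component, spaceName]
  vectors x := by simp [component, spaceName]
  vector_zero := by simp [component, spaceName]
  vector_add v w := by simp [component, spaceName, hE]
  vector_smul a v := by simp [component, spaceName, hE]

/-- This is the source of the `7` in `NameRel`: multiplication by the scalar `1` turns `IsCode` into
addition. -/
theorem ratCode_one : ratCode 1 = 7 := by
  simp [ratCode, Nat.pair]

theorem scal_seven : scal 7 = 1 := by rw [← ratCode_one, scal_ratCode]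

theorem mem_range_ratCode_iff {x : ℕ} : x ∈ Set.range ratCode ↔ ratCode (scal x) = x := by
  constructor
  · rintro ⟨q, rfl⟩
    rw [scal_ratCode]
  · exact fun h => ⟨_, h⟩

theorem nameRel_iff {V : Type} [AddCommGroup V] [Module ℚ V] {p : ℕ → ℕ} {E : ℕ → V}
    (hE : Function.Surjective E)
    (hlin : ∀ c x y z t, c ≤ t → x ≤ t → y ≤ t → z ≤ t →
      (IsLinear (stage (fun i => p (i + 1)) t) c x y z ↔ E z = scal c • E x + E y))
    {k m z : ℕ} (hm : m + 8 < k) (hz : z < k) :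
    NameRel (initSeg p k) m z ↔
      z = spaceName (p 0) E (vectorCode (fun i => p (i + 1)) E hE) m := by
  -- The prefix spends one entry on `n`, so `t` values of `f` are known; the margin `8` ensures that
  -- `t` also bounds the code `7`.
  obtain ⟨t, rfl⟩ : ∃ t, k = t + 1 := ⟨k - 1, by omega⟩
  set f : ℕ → ℕ := fun i => p (i + 1) with hf
  have hzt : z ≤ t := by omega
  have hx : m.unpair.2 ≤ t := (Nat.unpair_right_le m).trans (by omega)
  have ha : m.unpair.2.unpair.1 ≤ t := (Nat.unpair_left_le _).trans hx
  have hb : m.unpair.2.unpair.2 ≤ t := (Nat.unpair_right_le _).trans hx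
  have ha2 : m.unpair.2.unpair.1.unpair.2 ≤ t := (Nat.unpair_right_le _).trans ha
  have hb2 : m.unpair.2.unpair.2.unpair.2 ≤ t := (Nat.unpair_right_le _).trans hb
  have h7 : 7 ≤ t := by omega
  have h0 : 0 ≤ t := Nat.zero_le t
  have hE0 : E 0 = 0 := by
    have h0' : 0 ≤ 7 := Nat.zero_le 7
    have := (hlin 7 0 0 0 7 le_rfl h0' h0' h0').1 (by simp [IsLinear, total])
    rwa [scal_seven, one_smul, left_eq_add] at this
  -- A number is a vector if and only if it is the code of the vector that it denotes.
  have h5 : m.unpair.2 = vectorCode f E hE (E m.unpair.2.unpair.2) ↔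
      m.unpair.2 ∈ Set.range (vectorCode f E hE) := by
    constructor
    · exact fun h => ⟨_, h.symm⟩
    · rintro ⟨v, hv⟩
      rw [← hv, eval_vectorCode hE]
  rw [NameRel, tail_initSeg, headI_initSeg, ← hf, isCode_iff hE hlin h7 hb h0 hx,
    isCode_iff hE hlin h0 h0 h0 hzt, isCode_iff hE hlin h7 ha2 hb2 hzt,
    isCode_iff hE hlin ha hb2 h0 hzt, scal_seven, scal_zero, hE0, one_smul, one_smul, zero_smul,
    add_zero, add_zero, add_zero, h5, ← mem_range_ratCode_iff]
  simp only [spaceName]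
  rcases m.unpair.1 with _ | _ | _ | _ | _ | _ | _ | _ | i
  · simp
  · by_cases h : m.unpair.2 ∈ Set.range ratCode <;> simp only [h] <;> simp
  · simp
  · simp
  · simp
  · by_cases h : m.unpair.2 ∈ Set.range (vectorCode f E hE) <;> simp only [h] <;> simp
  · simp
  · simp
  · simp

end LimitSpace

/-! ### Decoding a basis, and the reduction of `CMaxSubset` to the basis problems. -/

section FromCMax

open Classical in
/-- The number of elements of `finsetOfCode y`, and its largest element. -/
noncomputable def cardMax (y : ℕ) : ℕ × ℕ :=
  (List.range y).foldl (fun s i => if i ∈ finsetOfCode y then (s.1 + 1, i) else s) (0, 0)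

theorem primrec_cardMax : Primrec cardMax := by
  classical
  have hi : Primrec fun b : ℕ × (ℕ × ℕ) × ℕ => b.2.2 := Primrec.snd.comp Primrec.snd
  have hs : Primrec fun b : ℕ × (ℕ × ℕ) × ℕ => b.2.1 := Primrec.fst.comp Primrec.snd
  have h : Primrec₂ fun (y : ℕ) (b : (ℕ × ℕ) × ℕ) =>
      if b.2 ∈ finsetOfCode y then (b.1.1 + 1, b.2) else b.1 :=
    Primrec.ite (primrecRel_mem_finsetOfCode.comp Primrec.fst hi)
      (Primrec.pair (Primrec.succ.comp (Primrec.fst.comp hs)) hi) hs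
  exact Primrec.list_foldl Primrec.list_range (Primrec.const (0, 0)) h

theorem cardMax_spec (y : ℕ) : (cardMax y).1 = (finsetOfCode y).card ∧
    (∀ i ∈ finsetOfCode y, i ≤ (cardMax y).2) ∧
    ((finsetOfCode y).Nonempty → (cardMax y).2 ∈ finsetOfCode y) := by
  classical
  have key : ∀ n, ∀ s : ℕ × ℕ, s = (List.range n).foldl
      (fun s i => if i ∈ finsetOfCode y then (s.1 + 1, i) else s) (0, 0) →
      s.1 = ((finsetOfCode y).filter (· < n)).card ∧
      (∀ i ∈ finsetOfCode y, i < n → i ≤ s.2) ∧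
      (((finsetOfCode y).filter (· < n)).Nonempty → s.2 ∈ finsetOfCode y) := by
    intro n
    induction n with
    | zero => simp
    | succ n ih =>
      rintro s rfl
      obtain ⟨h1, h2, h3⟩ := ih _ rfl
      rw [List.range_succ, List.foldl_append, List.foldl_cons, List.foldl_nil]
      split_ifs with hn
      · have hf : (finsetOfCode y).filter (· < n + 1) =
            insert n ((finsetOfCode y).filter (· < n)) := by
          ext i
          simp only [Finset.mem_filter, Finset.mem_insert]
          constructor
          · rintro ⟨hi, hin⟩
            rcases Nat.lt_succ_iff_lt_or_eq.1 hin with h | h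
            exacts [Or.inr ⟨hi, h⟩, Or.inl h]
          · rintro (rfl | ⟨hi, hin⟩)
            exacts [⟨hn, by omega⟩, ⟨hi, by omega⟩]
        rw [hf, Finset.card_insert_of_notMem (by simp), ← h1]
        exact ⟨rfl, fun i _ hi => by simp only; omega, fun _ => hn⟩
      · have hf : (finsetOfCode y).filter (· < n + 1) = (finsetOfCode y).filter (· < n) := by
          refine Finset.filter_congr fun i hi => ?_
          have : i ≠ n := fun h => hn (h ▸ hi)
          omega
        rw [hf]
        refine ⟨h1, fun i hi hin => h2 i hi ?_, h3⟩
        have : i ≠ n := fun h => hn (h ▸ hi)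
        omega
  have hf : (finsetOfCode y).filter (· < y) = finsetOfCode y :=
    Finset.filter_true_of_mem fun i hi => lt_of_mem_finsetOfCode hi
  obtain ⟨h1, h2, h3⟩ := key y _ rfl
  rw [hf] at h1 h3
  exact ⟨h1, fun i hi => h2 i hi (lt_of_mem_finsetOfCode hi), h3⟩

/-- Reads off a set outside the enumeration from a basis: the last vector of the basis knows the
stack at the time when it was introduced, and the size of the basis is the size of the limit of the
stack, plus one. -/
noncomputable def decodeBasis (y : ℕ) : ℕ :=
  (((0, 0) :: (stackState (Denumerable.ofNat (List ℕ) (cardMax y).2.unpair.1)).2.2.reverse).getD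
    ((cardMax y).1 - 1) (0, 0)).1

theorem primrec_decodeBasis : Primrec decodeBasis := by
  have hc := primrec_cardMax
  have hs := primrec_stackState.comp ((Primrec.ofNat (List ℕ)).comp
    (Primrec.fst.comp (Primrec.unpair.comp (Primrec.snd.comp hc))))
  exact Primrec.fst.comp ((Primrec.list_getD (0, 0)).comp
    (Primrec.list_cons.comp (Primrec.const (0, 0)) (Primrec.list_reverse.comp
      (Primrec.snd.comp (Primrec.snd.comp hs))))
    (Primrec.nat_sub.comp (Primrec.fst.comp hc) (Primrec.const 1)))

/-- Counted from the bottom, the top of `F` has position `F.length`. The extra entry at position `0`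
codes the empty set and serves the case `F = []`. -/
theorem getD_reverse_of_suffix {F S : List (ℕ × ℕ)} (h : F <:+ S) :
    ((0, 0) :: S.reverse).getD F.length (0, 0) = F.headI := by
  obtain ⟨G, rfl⟩ := h
  cases F with
  | nil => rfl
  | cons e F =>
    rw [List.length_cons, List.getD_cons_succ, List.reverse_append, List.reverse_cons]
    simp

theorem card_of_isBasis {K V : Type} [Field K] [AddCommGroup V] [Module K V] {ν : V → ℕ}
    (hν : Function.Injective ν) {B : Set V} (hB : LinearIndepOn K id B)
    (hspan : Submodule.span K B = ⊤) {y : ℕ} (hy : (finsetOfCode y : Set ℕ) = ν '' B) :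
    (finsetOfCode y).card = Module.finrank K V := by
  have hli : LinearIndependent K ((↑) : B → V) := hB
  rw [Module.finrank_eq_nat_card_basis (Module.Basis.mk hli (by rw [Subtype.range_coe, hspan])),
    ← Set.ncard_coe_finset, hy, Set.ncard_image_of_injective _ hν]
  rfl

theorem decodeBasis_eq {f : ℕ → ℕ} {F : List (ℕ × ℕ)} (hF : IsPermanent f F)
    {E : ℕ → ℚ × (Fin F.length → ℚ)} (hE : Function.Surjective E)
    (hE2 : ∀ x i, (E x).2 i = coef x (F.get i).2)
    {B : Set (ℚ × (Fin F.length → ℚ))} (hB : LinearIndepOn ℚ id B)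
    (hspan : Submodule.span ℚ B = ⊤) {y : ℕ}
    (hy : (finsetOfCode y : Set ℕ) = vectorCode f E hE '' B) : decodeBasis y = F.headI.1 := by
  obtain ⟨hcard, hmax, hmem⟩ := cardMax_spec y
  have hfin : (finsetOfCode y).card = F.length + 1 := by
    rw [card_of_isBasis (vectorCode_injective hE f) hB hspan hy, Module.finrank_prod,
      Module.finrank_self, Module.finrank_fin_fun, add_comm]
  obtain ⟨b, hbB, hb⟩ : (cardMax y).2 ∈ vectorCode f E hE '' B := by
    rw [← hy]
    exact hmem (Finset.card_pos.1 (by omega))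
  set x := (vectorCode f E hE b).unpair.2 with hx
  have hxw : (cardMax y).2 = historyCode f x := by rw [← hb, hx, ← vectorCode_eq]
  -- Otherwise all basis vectors are combinations older than the top generator of `F` and lie in the
  -- hyperplane where its coordinate is zero.
  have hage : F ≠ [] → F.headI.2 ≤ x := by
    intro hne
    by_contra hlt
    push Not at hlt
    have hpos : 0 < F.length := List.length_pos_iff.2 hne
    have hhead : F.get ⟨0, hpos⟩ = F.headI := by
      cases F with
      | nil => exact absurd rfl hne
      | cons e F => rfl
    have hker : B ⊆ LinearMap.ker
        ((LinearMap.proj (R := ℚ) (φ := fun _ : Fin F.length => ℚ) ⟨0, hpos⟩).comp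
          (LinearMap.snd ℚ ℚ (Fin F.length → ℚ))) := by
      intro v hv
      have hvy : vectorCode f E hE v ∈ finsetOfCode y := by
        rw [← Finset.mem_coe, hy]
        exact ⟨v, hv, rfl⟩
      have hle := hmax _ hvy
      rw [hxw, vectorCode_eq, (historyCode_strictMono f).le_iff_le] at hle
      have h0 : v.2 ⟨0, hpos⟩ = 0 := by
        rw [← eval_vectorCode hE f v, hE2, hhead]
        exact coef_eq_zero (hle.trans hlt.le)
      simpa using h0
    have htop : ((0, Pi.single ⟨0, hpos⟩ 1) : ℚ × (Fin F.length → ℚ)) ∈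
        Submodule.span ℚ B := hspan ▸ Submodule.mem_top
    have := Submodule.span_le.2 hker htop
    simp at this
  obtain ⟨T, hT⟩ := hF
  have hsuf : F <:+ (stage f x).2.2 :=
    suffix_stage_of_le (hT (max T x) (le_max_left _ _)) (le_max_right _ _) hage
  have hstate : stackState (Denumerable.ofNat (List ℕ) (cardMax y).2.unpair.1) = stage f x := by
    rw [hxw, historyCode, Nat.unpair_pair, Denumerable.ofNat_encode, stage]
  rw [decodeBasis, hstate, hcard, hfin, Nat.add_sub_cancel, getD_reverse_of_suffix hsuf]

/-- If `P` is the problem of finding a basis on the names of bounded-dimensional vector spaces over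
`ℚ`, then it solves `C^⊂_max`. -/
theorem cMaxSubset_reducible {P : WeihrauchProblem}
    (hP : ∀ (p : ℕ → ℕ) (V : Type) [AddCommGroup V] [Module ℚ V] (ν : V → ℕ),
      IsVectorSpaceName p ratCode ν →
      (∀ S : Finset V, S.card = component p 0 0 → ¬ LinearIndepOn ℚ id (S : Set V)) →
      ∀ x, (p, x) ∈ P ↔ ∃ B : Set V, LinearIndepOn ℚ id B ∧ Submodule.span ℚ B = ⊤ ∧
        (finsetOfCode x : Set ℕ) = ν '' B) :
    StrongWeihrauchReducible CMaxSubset P := by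
  refine ⟨searchFunctional NameRel 8, (primrec₂_searchFunctional primrecPred_nameRel).to_comp,
    fun y => Part.some (decodeBasis y), primrec_decodeBasis.to_comp.partrec, ?_⟩
  rintro p ⟨x₀, n, g, X₀, hn, hg, -, hne, hlarge, -, -⟩
  set f : ℕ → ℕ := fun i => p (i + 1) with hf
  have hg' : g = fun k => finsetOfCode (f k) := funext fun k => (hg k).symm
  subst hg'
  have hrange : ∀ y, finsetOfCode y ∈ Set.range (fun k => finsetOfCode (f k)) ↔
      y ∈ Set.range f := fun y => exists_congr fun k => finsetOfCode_injective.eq_iff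
  have h0 : 0 ∉ Set.range f := by
    rintro ⟨k, hk⟩
    exact hne k (by simp only [hk, finsetOfCode_zero])
  have hlarge' : ∀ y, n ≤ (finsetOfCode y).card → y ∈ Set.range f := fun y hy =>
    (hrange y).1 (hlarge _ hy)
  obtain ⟨F, hF⟩ := exists_isLimitStack h0 hlarge'
  obtain ⟨E, hE, hE2, hlin⟩ := hF.exists_eval
  set q := spaceName (p 0) E (vectorCode f E hE) with hq
  have hname : IsVectorSpaceName q ratCode (vectorCode f E hE) :=
    isVectorSpaceName_spaceName _ (vectorCode_injective hE f) (eval_vectorCode hE f)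
  -- The generator `0` adds one dimension: `F.length + 1 ≤ n`, so sets of `n + 1` vectors are
  -- dependent.
  have hq0 : component q 0 0 = n + 1 := by simp [component, hq, spaceName, hn]
  have hdim : ∀ S : Finset (ℚ × (Fin F.length → ℚ)), S.card = component q 0 0 →
      ¬ LinearIndepOn ℚ id (S : Set (ℚ × (Fin F.length → ℚ))) := by
    intro S hS hli
    have hle := LinearIndependent.finset_card_le_finrank (b := S) hli
    rw [Module.finrank_prod, Module.finrank_self, Module.finrank_fin_fun, hS, hq0] at hle
    have := hF.1.length_lt h0 hlarge'
    omega
  have hsol := hP q _ _ hname hdim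
  refine ⟨q, functionalValue_search fun k m z hm hz => nameRel_iff hE hlin hm hz, ?_, ?_⟩
  · obtain ⟨B, -, -, hspan, hli⟩ := exists_linearIndepOn_id_extension
      (K := ℚ) (V := ℚ × (Fin F.length → ℚ)) (linearIndepOn_empty ℚ id) (Set.empty_subset Set.univ)
    have hfin : B.Finite := hli.setFinite
    obtain ⟨x, hx⟩ := finsetOfCode_surjective (hfin.toFinset.image (vectorCode f E hE))
    refine ⟨x, (hsol x).2 ⟨B, hli, ?_, by simp [hx]⟩⟩
    rw [Submodule.eq_top_iff']
    exact fun v => hspan (Set.mem_univ v)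
  · intro y hy
    obtain ⟨B, hB, hspan, hyB⟩ := (hsol y).1 hy
    refine ⟨_, Part.mem_some _, ?_⟩
    rw [decodeBasis_eq hF.1 hE hE2 hB hspan hyB]
    refine ⟨n, _, _, hn, hg, rfl, hne, hlarge, ?_, fun Y hY => ?_⟩
    · rw [hrange]
      exact hF.1.headI_notMem_range h0
    · obtain ⟨y', rfl⟩ := finsetOfCode_surjective Y
      exact (hrange y').2 (hF.mem_range_of_ssubset hY)

end FromCMax

theorem mainTheorem6 :
    StrongWeihrauchEquiv VSBBounded CMaxSubset ∧
      StrongWeihrauchEquiv VSBBoundedRat CMaxSubset := by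
  exact ⟨⟨vsbBounded_reducible_cMaxSubset,
      cMaxSubset_reducible fun _ _ _ _ _ h hn => mem_vsbBounded_iff h hn⟩,
    ⟨vsbBoundedRat_reducible_cMaxSubset,
      cMaxSubset_reducible fun _ _ _ _ _ h hn => mem_vsbBoundedRat_iff h hn⟩⟩
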